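/- **Setting.** Let $f_{abc}$ be the completely antisymmetric structure constants of a Lie algebra in an orthonormal basis $\xi_a$ ($[\xi_a,\xi_b]=if_{abc}\xi_c$), $\langle\xi_a|\xi_b\rangle=\delta_{ab}$, and consider the free Lie-algebra valued string-localized gluon potential $A_\mu$, its field strength $F_{\mu\nu}$, the field $w$ with string variation $\delta_cA_\mu=\partial_\mu w$, and massless quarks with currents $j^\mu_a=\overline\psi\gamma^\mu\pi(\xi_a)\psi$; Wick ordering is understood, and $F_{\mu\nu}=\partial_\mu A_\nu-\partial_\nu A_\mu$, $\partial^\mu F_{\mu\nu}=0$, $\partial^\mu A_\mu=0$, $\square w=0$, $\gamma^\mu\partial_\mu\psi=0$. The metric is $\eta=\mathrm{diag}(1,-1,-1,-1)$. Primes denote the arguments $x',x''$; $\delta_{xx'}=\delta(x-x')$; $I^\nu$ and $I'^\nu$ denote string integration in the first and in the second argument of a kernel, treated as commuting formal operations with $I^\nu\partial_\nu=-1$, $I'^\nu\partial_\nu=+1$ on functions of $x-x'$; $(II')=I^\nu I'_\nu$. $\mathfrak S$ denotes the average over permutations of the arguments, and $X^{[\kappa}Y^{\lambda]}=X^\kappa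 Y^\lambda-X^\lambda Y^\kappa$. Let $$L_1=\tfrac12\langle F^{\mu\nu}|i[A_\mu,A_\nu]\rangle+\langle A_\mu|j^\mu\rangle,\qquad Q_1^\mu=\langle F^{\mu\nu}|i[w,A_\nu]\rangle+\langle w|j^\mu\rangle,$$ $$L_2=-\tfrac12(1+c_F)\langle i[A^\mu,A^\nu]|i[A_\mu,A_\nu]\rangle,\qquad Q_2^\mu(x;x')=Q_2^\mu|_\delta+2\Big\langle\frac{\partial Q_1^\mu}{\partial w}(x)\Big|w_2(x,x')\Big\rangle,$$ $$Q_2^\mu|_\delta=-2(1+c_F)\langle i[A^\mu,A^\nu]|i[w,A_\nu]\rangle\,\delta_{xx'},\qquad w_2(x,x')=i[w',A'_\nu]\cdot I^\nu\delta_{xx'},$$ where $c_F\in\mathbb R$. For a Wick polynomial $Y^\mu$ in the undifferentiated fields put $O_Y(X')=T[\partial_\mu Y^\mu\,X']-\partial_\mu T[Y^\mu X']$ (tree level), computed by Wick's theorem with two-point obstructions $O_\mu(\varphi,\chi')=\langle T\partial_\mu\varphi\,\chi'\rangle-\partial_\mu\langle T\varphi\,\chi'\rangle$ (all proportional to $\delta_{ab}$)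 that are chosen as $$O_\mu(F^{\mu\nu},F'^{\kappa\lambda})=-(1+c_F)\eta^{\nu[\kappa}\partial^{\lambda]}i\delta_{xx'},\quad O_\mu(F^{\mu\nu},A'^\kappa)=-(\eta^{\nu\kappa}-I'^\nu\partial^\kappa)i\delta_{xx'},\quad O_\mu(w,\cdot)=0,$$ $$O_\mu(A_\nu,A'^\kappa)=\big(\tfrac32(I'_\mu\partial_\nu+I'_\nu\partial_\mu)-\eta_{\mu\nu}\big)I^\kappa\,i\delta_{xx'}+\tfrac14\eta_{\mu\nu}(II')\partial^\kappa\,i\delta_{xx'},$$ $$O_\mu(A_\nu,F'^{\kappa\lambda})=-\tfrac12c_F\,\delta_\mu^{[\kappa}\delta_\nu^{\lambda]}\,i\delta_{xx'}-\tfrac14\eta_{\mu\nu}I^{[\kappa}\partial^{\lambda]}\,i\delta_{xx'},$$ and, for currents, $O_{j_a}(j'^\kappa_b)=-f_{abc}j^\kappa_c\,i\delta_{xx'}$. The symbols $|_\delta$ and $|_{I\delta}$ denote the parts that come from two-point obstructions without and with string integrations, respectively. For $Y\cdot\delta_{xx'}$, the obstruction symmetrized in $x,x'$ is computed by taking the undifferentiated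 $\delta_{xx'}$ out of the $T$-product: $2\mathfrak S_{xx'}O_{Y\delta_{xx'}}(X'')=T[(\partial+\partial')_\mu(Y^\mu\delta_{xx'})X'']-(\partial+\partial')_\mu T[Y^\mu\delta_{xx'}X'']$. A *total derivative* is a sum of derivatives $\partial_\mu,\partial'_\mu,\partial''_\mu$ of Wick polynomials in the fields at $x,x',x''$ whose coefficients are products of derivatives of (string-integrated) delta functions. **Proposition.** (i) The term $O_{Q_2|_\delta}(L_1'')$, symmetrized in $x,x'$, and likewise its part $O_{Q_2|_\delta}(L_1'')|_{I\delta}$, is a total derivative up to violations of axiality, i.e. up to terms in which a string-integrated delta function $I^\nu\delta$ or $I'^\nu\delta$ (possibly with further operations on $\delta$) is contracted with a field $A_\nu$ at one of its two arguments. (ii) For a sharp string, i.e. if $I^\nu=e^\nu I_e$, $I'^\nu=e^\nu I'_e$ and $e^\nu A_\nu=0$ with $e$ spacelike, $e^2=-1$, one has $w_2=0$, $O_{Q_2|_\delta}(L_1'')|_{I\delta}$ is a total derivative, and so is the remainder $$\mathfrak S_{xx'x''}\Big[\Big\langle\frac{\partial Q_2}{\partial w_2}\Big|O(w_2,L_1'')\Big\rangle+O_{Q_2|_\delta}(L_1'')|_{I\delta}\Big],$$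 for every linear prescription for the $T$-products of $w_2$ and $\partial_\mu w_2$ with $L_1''$ that depends only on the fields (so that vanishing kernels have vanishing $T$-products). (iii) Moreover $O_{Q_1}(L_2')|_\delta\,\delta_{x'x''}+O_{Q_2|_\delta}(L_1'')|_\delta=0$, and, for a sharp string, $\mathfrak S_{xx'x''}\big[\langle w_2|O(\frac{\partial Q_2}{\partial w_2},L_1'')\rangle+O_{Q_1}(L_2')|_{I\delta}\,\delta_{x'x''}\big]$ is a total derivative. Hence, for a sharp string, the third-order obstruction $O^{(3)}=3\mathfrak S_{xx'x''}\big(O_{Q_1}(L_2')\,\delta_{x'x''}+O_{Q_2(x;x')}(L_1'')\big)$ satisfies $$O^{(3)}=\delta_cL_3\cdot\delta_{xx'x''}-\mathfrak S_{xx'x''}\partial_\mu Q_3^\mu(x;x',x'')$$ with $L_3=0$ and some $Q_3$ all of whose terms contain a string-integrated delta function. -/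

import Mathlib

open MvPolynomial

noncomputable section

namespace SQCD

/-! Wick-ordered products are (super)commutative, and they enter only through charge-neutral
combinations.  A Wick polynomial with distributional coefficients in the three space-time points
`x = x 0`, `x' = x 1`, `x'' = x 2` is therefore an element of a commutative polynomial algebra whose
generators are the derivatives of the linear free fields at the three points, and the kernels
`(p T_0)(x i - x j)` and `(p δ)(x i - x j)`, where `p` is a monomial in derivatives and string
integrations.  Two elements are the same field iff their difference lies in the differential
ideal `onShell` of the free field equations and of the identities between kernels.

All Lorentz indices of generators are lower ones, except those of string integrations and currents,
which are upper ones.  The metric has signature `(+,-,-,-)`. -/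

/-- The diagonal entries of the Minkowski metric. -/
def g (μ : Fin 4) : ℂ := if μ = 0 then 1 else -1

/-- The Minkowski metric `η_{μν}`. -/
def η (μ ν : Fin 4) : ℂ := if μ = ν then g μ else 0

/-- The data of the model: completely antisymmetric structure constants of a Lie algebra in a basis
that is orthonormal for the invariant inner product, a representation `π` of it on the quark
multiplet with `t a = π (ξ_a)` and `[t a, t b] = i f_{abc} t c`, gamma matrices, and the
renormalization constant `c_F` of the propagator of `F`.  Pure Yang-Mills theory is `r = 0`. -/
structure Model where
  N : ℕ
  f : Fin N → Fin N → Fin N → ℝ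
  f_swap_left : ∀ a b c, f b a c = -f a b c
  f_swap_right : ∀ a b c, f a c b = -f a b c
  jacobi : ∀ a b c d, ∑ e, (f a b e * f e c d + f b c e * f e a d + f c a e * f e b d) = 0
  r : ℕ
  t : Fin N → Matrix (Fin r) (Fin r) ℂ
  t_comm : ∀ a b, t a * t b - t b * t a = ∑ c, (Complex.I * (f a b c : ℂ)) • t c
  γ : Fin 4 → Matrix (Fin 4) (Fin 4) ℂ
  clifford : ∀ μ ν, γ μ * γ ν + γ ν * γ μ = (2 * η μ ν) • (1 : Matrix (Fin 4) (Fin 4) ℂ)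
  cF : ℝ

/-- The linear gluon fields: the string-localized potential `A_μ^a(c)`, the field strength
`F_{μν}^a` and the string variation field `w^a`. -/
inductive GluonField (N : ℕ) where
  | A (a : Fin N) (μ : Fin 4) : GluonField N
  | F (a : Fin N) (μ ν : Fin 4) : GluonField N
  | w (a : Fin N) : GluonField N

/-- The multi-index of a derivative. -/
abbrev Jet := Fin 4 →₀ ℕ

/-- The multi-index of `∂_μ`. -/
def e1 (μ : Fin 4) : Jet := Finsupp.single μ 1

/-- A derivative of a component of the quark field `ψ` (or of its adjoint) at a point. -/
structure QuarkJet (r : ℕ) where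
  point : Fin 3
  spin : Fin 4
  color : Fin r
  jet : Jet

/-- Elementary operations on kernels: the derivative `∂_μ` with respect to the first argument, the
string integration `I^μ` in the first and `I'^μ` in the second argument, and the string operation
`∫ dσ(e) b^κ(e) e^ν ∫ s ds` (which yields `w` when it is contracted with `F_{κν}`) in the first and
in the second argument. -/
inductive KOp where
  | d (μ : Fin 4) : KOp
  | s (μ : Fin 4) : KOp
  | s' (μ : Fin 4) : KOp
  | v (κ ν : Fin 4) : KOp
  | v' (κ ν : Fin 4) : KOp

/-- Interchange of the two arguments of a kernel (up to the sign of derivatives). -/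
def KOp.swap : KOp → KOp
  | .d μ => .d μ
  | .s μ => .s' μ
  | .s' μ => .s μ
  | .v κ ν => .v' κ ν
  | .v' κ ν => .v κ ν

/-- The kernels on which they act: the massless time-ordered function `T_0` and the delta function. -/
inductive Base where
  | T0 : Base
  | delta : Base

/-- Generators: derivatives of gluon fields at the three points, derivatives of Wick-ordered quark
bilinears, and the kernels `(m T_0)(x i - x j)`, `(m δ)(x i - x j)`. -/
inductive Gen (N r : ℕ) where
  | field (i : Fin 3) (φ : GluonField N) (α : Jet) : Gen N r
  | bil (p q : QuarkJet r) : Gen N r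
  | kern (i j : Fin 3) (b : Base) (m : KOp →₀ ℕ) : Gen N r

/-- Multilocal Wick polynomials with kernels as coefficients, before the field equations. -/
abbrev Wick (M : Model) := MvPolynomial (Gen M.N M.r) ℂ

/-- Polynomials in the elementary operations on kernels. -/
abbrev KPoly := MvPolynomial KOp ℂ

/-- `∂_μ`, as an operation on kernels. -/
def pd (μ : Fin 4) : KPoly := X (KOp.d μ)
/-- The string integration `I_μ` in the first argument. -/
def st (μ : Fin 4) : KPoly := C (g μ) * X (KOp.s μ)
/-- The string integration `I'_μ` in the second argument. -/
def st' (μ : Fin 4) : KPoly := C (g μ) * X (KOp.s' μ)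
/-- `(I I') = I^μ I'_μ`. -/
def stst : KPoly := ∑ μ, X (KOp.s μ) * st' μ

section
variable {M : Model}

/-- The derivative `∂_{α}` of the gluon field `φ` at `x i`. -/
def fld (i : Fin 3) (φ : GluonField M.N) (α : Jet) : Wick M := X (Gen.field i φ α)

/-- The kernel `(p T_0)(x i - x j)` or `(p δ)(x i - x j)`. -/
def ker (i j : Fin 3) (b : Base) : KPoly →ₗ[ℂ] Wick M :=
  (MvPolynomial.basisMonomials KOp ℂ).constr ℂ (fun m => (X (Gen.kern i j b m) : Wick M))

/-- `δ(x i - x j)`. -/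
def dlt (i j : Fin 3) : Wick M := ker i j Base.delta 1

/-- The kernel `p i δ(x i - x j)`, with the imaginary unit. -/
def idlt (i j : Fin 3) (p : KPoly) : Wick M := C Complex.I * ker i j Base.delta p

/-- The derivative `∂_μ` with respect to the point `x i`. -/
def D (i : Fin 3) (μ : Fin 4) : Derivation ℂ (Wick M) (Wick M) :=
  mkDerivation ℂ fun G : Gen M.N M.r => match G with
    | .field k φ α => if k = i then X (Gen.field k φ (α + e1 μ)) else 0
    | .bil p q =>
        (if p.point = i then X (Gen.bil { p with jet := p.jet + e1 μ } q) else 0)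
        + (if q.point = i then X (Gen.bil p { q with jet := q.jet + e1 μ }) else 0)
    | .kern j k b m =>
        (if j = i then X (Gen.kern j k b (m + Finsupp.single (KOp.d μ) 1)) else 0)
        - (if k = i then X (Gen.kern j k b (m + Finsupp.single (KOp.d μ) 1)) else 0)

/-- Renaming of the three points. -/
def Gen.perm {N r : ℕ} (σ : Equiv.Perm (Fin 3)) : Gen N r → Gen N r
  | .field i φ α => .field (σ i) φ α
  | .bil p q => .bil { p with point := σ p.point } { q with point := σ q.point }
  | .kern i j b m => .kern (σ i) (σ j) b m

/-- The symmetrization `𝔖_{xx'x''}` (average over all permutations of the points). -/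
def sym3 (P : Wick M) : Wick M :=
  C (1 / 6) * ∑ σ : Equiv.Perm (Fin 3), rename (Gen.perm σ) P

end

/-! ### Identities between fields and between kernels -/

/-- The field equations of the free fields, and the identities between kernels that hold
for every smearing of the string with total weight one. -/
inductive Rel (M : Model) : Wick M → Prop
  /-- `F_{μν} = ∂_μ A_ν - ∂_ν A_μ` -/
  | curl (i : Fin 3) (a : Fin M.N) (μ ν : Fin 4) (α : Jet) : Rel M
      (fld i (.F a μ ν) α - (fld i (.A a ν) (α + e1 μ) - fld i (.A a μ) (α + e1 ν)))
  /-- `∂^μ F_{μν} = 0` -/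
  | divF (i : Fin 3) (a : Fin M.N) (ν : Fin 4) (α : Jet) : Rel M
      (∑ μ, C (g μ) * fld i (.F a μ ν) (α + e1 μ))
  /-- `∂^μ A_μ = 0` -/
  | divA (i : Fin 3) (a : Fin M.N) (α : Jet) : Rel M
      (∑ μ, C (g μ) * fld i (.A a μ) (α + e1 μ))
  /-- `□ w = 0` -/
  | boxw (i : Fin 3) (a : Fin M.N) (α : Jet) : Rel M
      (∑ μ, C (g μ) * fld i (.w a) (α + e1 μ + e1 μ))
  /-- The massless Dirac equation `γ^μ ∂_μ ψ = 0` -/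
  | dirac (p : QuarkJet M.r) (i : Fin 3) (s : Fin 4) (n : Fin M.r) (α : Jet) : Rel M
      (∑ μ, ∑ s', C (M.γ μ s s') * X (Gen.bil p ⟨i, s', n, α + e1 μ⟩))
  /-- The adjoint Dirac equation `∂_μ ψ̄ γ^μ = 0` -/
  | dirac' (q : QuarkJet M.r) (i : Fin 3) (s : Fin 4) (n : Fin M.r) (α : Jet) : Rel M
      (∑ μ, ∑ s', C (M.γ μ s' s) * X (Gen.bil ⟨i, s', n, α + e1 μ⟩ q))
  /-- Quark fields anticommute in Wick products. -/
  | pauli (p q p' q' : QuarkJet M.r) : Rel M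
      (X (Gen.bil p q) * X (Gen.bil p' q') + X (Gen.bil p q') * X (Gen.bil p' q))
  /-- `I^μ ∂_μ = -1` -/
  | string (i j : Fin 3) (b : Base) (p : KPoly) : Rel M
      (ker i j b (p * (∑ μ, X (KOp.s μ) * pd μ + 1)))
  /-- `I'^μ ∂'_μ = -1`, where `∂' = -∂` -/
  | string' (i j : Fin 3) (b : Base) (p : KPoly) : Rel M
      (ker i j b (p * (∑ μ, X (KOp.s' μ) * pd μ - 1)))
  /-- `□ T_0 = -i δ` -/
  | boxT (i j : Fin 3) (p : KPoly) : Rel M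
      (ker i j Base.T0 (p * ∑ μ, C (g μ) * pd μ * pd μ) + idlt i j p)
  /-- Interchange of the arguments of a kernel; `δ` and `T_0` are even. -/
  | swap (i j : Fin 3) (b : Base) (m : KOp →₀ ℕ) : Rel M
      (X (Gen.kern j i b (m.mapDomain KOp.swap))
        - C ((-1) ^ (∑ μ, m (KOp.d μ))) * X (Gen.kern i j b m))
  /-- `φ(x) δ(x - x') = φ(x') δ(x - x')`, for gluon fields -/
  | loc (i j : Fin 3) (h : i ≠ j) (φ : GluonField M.N) (α : Jet) : Rel M
      (dlt i j * (fld i φ α - fld j φ α))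
  /-- the same for the field `ψ̄` in a bilinear -/
  | locbil (i j : Fin 3) (h : i ≠ j) (s : Fin 4) (n : Fin M.r) (α : Jet) (q : QuarkJet M.r) : Rel M
      (dlt i j * (X (Gen.bil ⟨i, s, n, α⟩ q) - X (Gen.bil ⟨j, s, n, α⟩ q)))
  /-- the same for the field `ψ` in a bilinear -/
  | locbil' (i j : Fin 3) (h : i ≠ j) (s : Fin 4) (n : Fin M.r) (α : Jet) (p : QuarkJet M.r) : Rel M
      (dlt i j * (X (Gen.bil p ⟨i, s, n, α⟩) - X (Gen.bil p ⟨j, s, n, α⟩)))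
  /-- the same for kernels -/
  | locker (i j k : Fin 3) (h : i ≠ j) (hi : k ≠ i) (hj : k ≠ j) (b : Base) (p : KPoly) : Rel M
      (dlt i j * (ker i k b p - ker j k b p))

/-- The additional identities for a sharp string in the direction `e` (upper components):
axiality `e^μ A_μ(e) = 0`, and `I^μ = e^μ I_e`, `I'^μ = e^μ I'_e`, where `I_e = -e_ν I^ν` because of
`e_ν e^ν = -1`. -/
inductive SharpRel (M : Model) (e : Fin 4 → ℝ) : Wick M → Prop
  | axial (i : Fin 3) (a : Fin M.N) (α : Jet) : SharpRel M e
      (∑ μ, C (e μ : ℂ) * fld i (.A a μ) α)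
  | dir (i j : Fin 3) (b : Base) (p : KPoly) (μ : Fin 4) : SharpRel M e
      (ker i j b (p * (X (KOp.s μ) + C (e μ : ℂ) * ∑ ν, C (g ν * (e ν : ℂ)) * X (KOp.s ν))))
  | dir' (i j : Fin 3) (b : Base) (p : KPoly) (μ : Fin 4) : SharpRel M e
      (ker i j b (p * (X (KOp.s' μ) + C (e μ : ℂ) * ∑ ν, C (g ν * (e ν : ℂ)) * X (KOp.s' ν))))

/-- The smallest ideal that contains `S` and is stable under all derivatives. -/
def diffIdeal {M : Model} (S : Set (Wick M)) : Ideal (Wick M) :=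
  sInf {J | S ⊆ J ∧ ∀ i μ, ∀ P ∈ J, D i μ P ∈ J}

/-- The Wick polynomials that vanish, for a smeared string. -/
def onShell (M : Model) : Ideal (Wick M) := diffIdeal {P | Rel M P}

/-- The Wick polynomials that vanish, for a sharp string in the direction `e`. -/
def onShellSharp (M : Model) (e : Fin 4 → ℝ) : Ideal (Wick M) :=
  diffIdeal {P | Rel M P ∨ SharpRel M e P}

/-- The violations of axiality: sums of terms in which a string-integrated delta function
`I^μ (p δ)(x i - x j)` or `I'^μ (p δ)(x i - x j)` is contracted with a field `A_μ` at `x i` or `x j`. -/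
def axialityViolations (M : Model) : Ideal (Wick M) :=
  Ideal.span {P | ∃ (i j k : Fin 3) (a : Fin M.N) (p : KPoly), i ≠ j ∧ (k = i ∨ k = j) ∧
    (P = ∑ μ, ker i j Base.delta (p * X (KOp.s μ)) * fld k (.A a μ) 0 ∨
     P = ∑ μ, ker i j Base.delta (p * X (KOp.s' μ)) * fld k (.A a μ) 0)}

/-- The ideal of Wick polynomials all of whose terms contain a string-integrated delta function. -/
def stringTerms (M : Model) : Ideal (Wick M) :=
  Ideal.span {P | ∃ (i j : Fin 3) (μ : Fin 4) (p : KPoly),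
    P = ker i j Base.delta (p * X (KOp.s μ)) ∨ P = ker i j Base.delta (p * X (KOp.s' μ))}

/-- The multilocal Wick polynomials whose coefficients are products of derivatives of delta
functions and of string-integrated delta functions.  (The function `T_0` is not admitted.) -/
def stringLocal (M : Model) : Subalgebra ℂ (Wick M) :=
  supported ℂ {G : Gen M.N M.r | match G with
    | .field _ _ _ => True
    | .bil _ _ => True
    | .kern _ _ .T0 _ => False
    | .kern _ _ .delta m => ∀ κ ν, m (KOp.v κ ν) = 0 ∧ m (KOp.v' κ ν) = 0}

/-- `P` is a total derivative (of string-localized quantities), modulo `J`. -/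
def IsTotalDerivative {M : Model} (J : Ideal (Wick M)) (P : Wick M) : Prop :=
  ∃ Q : Fin 3 → Fin 4 → Wick M, (∀ i μ, Q i μ ∈ stringLocal M) ∧
    P - ∑ i, ∑ μ, D i μ (Q i μ) ∈ J

/-! ### Propagators and two-point obstructions

The propagators are the kernels `kin φ χ T_0 + ren φ χ iδ`.  The two-point obstructions
`O_μ(φ, χ')` are given as operations on `iδ`. The indices of `A`, `F` are lower ones, and all entries
carry a factor `δ_{ab}`.  The second entry is always one of the fields `A`, `F`: the values at
`χ = w` are never used. -/

/-- The Kronecker symbol of the Lie algebra indices. -/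
def kd {N : ℕ} (a b : Fin N) : ℂ := if a = b then 1 else 0

/-- The propagators of `F` with `F'` and `A'`, without the factor `δ_{ab}`. -/
def kinF {N : ℕ} (μ ν : Fin 4) : GluonField N → KPoly
  | .F _ κ l => -(pd μ * C (η ν κ) * pd l - pd ν * C (η μ κ) * pd l
      - pd μ * C (η ν l) * pd κ + pd ν * C (η μ l) * pd κ)
  | .A _ κ => -(pd μ * C (η ν κ) - pd ν * C (η μ κ) - (pd μ * st' ν - pd ν * st' μ) * pd κ)
  | .w _ => 0

/-- The propagators of `A` with `F'` and `A'`, without the factor `δ_{ab}`. -/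
def kinA {N : ℕ} (μ : Fin 4) : GluonField N → KPoly
  | .F _ κ l => -(C (η μ κ) * pd l - C (η μ l) * pd κ + pd μ * (st κ * pd l - st l * pd κ))
  | .A _ κ => -(C (η μ κ) + pd μ * st κ - st' μ * pd κ - stst * pd μ * pd κ)
  | .w _ => 0

/-- The Lie algebra index of a field. -/
def GluonField.idx {N : ℕ} : GluonField N → Fin N
  | .A a _ => a
  | .F a _ _ => a
  | .w a => a

/-- The kinematic propagators, as operations on `T_0`. -/
def kin {N : ℕ} (φ χ : GluonField N) : KPoly :=
  C (kd φ.idx χ.idx) * match φ with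
    | .F _ μ ν => kinF μ ν χ
    | .A _ μ => kinA μ χ
    | .w _ => ∑ κ, ∑ ν, X (KOp.v κ ν) * kinF κ ν χ

/-- The renormalization of the propagator of `F` with `F'`, as an operation on `iδ`. -/
def ren (M : Model) (φ χ : GluonField M.N) : KPoly :=
  match φ, χ with
    | .F a μ ν, .F b κ l =>
        C (-(M.cF : ℂ) * kd a b * (η μ κ * η ν l - η μ l * η ν κ))
    | _, _ => 0

/-- A table of two-point obstructions `O_μ(φ, χ')`. -/
abbrev ObsTable (M : Model) := Fin 4 → GluonField M.N → GluonField M.N → KPoly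

/-- `O_ρ(F_{μν}, ·)` with prescribed divergence `V_ν = O^μ(F_{μν}, ·)`, compatible with the Bianchi
identity.  Only the divergence enters below, because `F` enters the left factors
only through the contraction `F^{μν}` with the index `μ` of the derivative. -/
def fromDiv (V : Fin 4 → KPoly) (ρ μ ν : Fin 4) : KPoly :=
  C (1 / 3) * (C (η ρ μ) * V ν - C (η ρ ν) * V μ)

/-- The parts of the two-point obstructions that contain delta functions:
`O_μ(F^{μν}, F'^{κλ}) = -(1+c_F) η^{ν[κ}∂^{λ]} iδ`, `O_μ(F^{μν}, A'^κ)|_δ = -η^{νκ} iδ`,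
`O_μ(A_ν, F'^{κλ})|_δ = -½ c_F δ_μ^{[κ} δ_ν^{λ]} iδ`, and all others zero. -/
def oDelta (M : Model) : ObsTable M := fun ρ φ χ =>
  C (kd φ.idx χ.idx) * match φ, χ with
    | .F _ μ ν, .F _ κ l =>
        fromDiv (fun n => C (-(1 + (M.cF : ℂ))) * (C (η n κ) * pd l - C (η n l) * pd κ)) ρ μ ν
    | .F _ μ ν, .A _ κ => fromDiv (fun n => -C (η n κ)) ρ μ ν
    | .A _ ν, .F _ κ l => C (-(1 / 2) * (M.cF : ℂ) * (η ρ κ * η ν l - η ρ l * η ν κ))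
    | _, _ => 0

/-- The parts of the two-point obstructions that contain string-integrated delta functions:
`O_μ(F^{μν}, A'^κ)|_{Iδ} = I'^ν ∂^κ iδ`,
`O_μ(A_ν, A'^κ) = ((3/2)(I'_μ ∂_ν + I'_ν ∂_μ) - η_{μν}) I^κ iδ + ¼ η_{μν} (II') ∂^κ iδ`,
`O_μ(A_ν, F'^{κλ})|_{Iδ} = -¼ η_{μν} I^{[κ}∂^{λ]} iδ`, and all others zero. -/
def oString (M : Model) : ObsTable M := fun ρ φ χ =>
  C (kd φ.idx χ.idx) * match φ, χ with
    | .F _ μ ν, .A _ κ => fromDiv (fun n => st' n * pd κ) ρ μ ν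
    | .A _ ν, .A _ κ =>
        (C (3 / 2) * (st' ρ * pd ν + st' ν * pd ρ) - C (η ρ ν)) * st κ
          + C (1 / 4 * η ρ ν) * stst * pd κ
    | .A _ ν, .F _ κ l => -(C (1 / 4 * η ρ ν) * (st κ * pd l - st l * pd κ))
    | _, _ => 0

/-- All two-point obstructions. -/
def oFull (M : Model) : ObsTable M := fun ρ φ χ => oDelta M ρ φ χ + oString M ρ φ χ

section
variable {M : Model}

/-- The propagator `⟨T φ(x i) χ(x j)⟩`. -/
def prop (i j : Fin 3) (φ χ : GluonField M.N) : Wick M :=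
  ker i j Base.T0 (kin φ χ) + idlt i j (ren M φ χ)

/-- The propagator `⟨T ∂_μφ(x i) χ(x j)⟩ := ∂_μ ⟨T φ(x i) χ(x j)⟩ + O_μ(φ(x i), χ(x j))`. -/
def dprop (o : ObsTable M) (i j : Fin 3) (μ : Fin 4) (φ χ : GluonField M.N) : Wick M :=
  D i μ (prop i j φ χ) + idlt i j (o μ φ χ)

/-- Sum over the fields `A`, `F`. -/
def sumAF (h : GluonField M.N → Wick M) : Wick M :=
  ∑ a, ((∑ μ, h (.A a μ)) + ∑ μ, ∑ ν, h (.F a μ ν))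

/-- Sum over the fields `A`, `F`, `w`. -/
def sumAFw (h : GluonField M.N → Wick M) : Wick M :=
  sumAF h + ∑ a, h (.w a)

/-- The time-ordered product `T[W(x i) V(x j)]` at tree level, by Wick's theorem, for a Wick
polynomial `W` in the gluon fields and their first derivatives at `x i`, and `V` in the undifferentiated
fields `A`, `F` at `x j`.  (The Wick product of `W` and `V` itself is omitted: it commutes
with derivatives.  Contractions of quark fields do not occur as long as one of the factors
does not contain quark fields.) -/
def Tprod (o : ObsTable M) (i j : Fin 3) (W V : Wick M) : Wick M :=
  sumAFw fun φ => sumAF fun χ =>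
    (pderiv (Gen.field i φ 0) W * prop i j φ χ
      + ∑ μ, pderiv (Gen.field i φ (e1 μ)) W * dprop o i j μ φ χ)
    * pderiv (Gen.field j χ 0) V

/-- The obstruction map `O_{Y(x i)}(V(x j)) = T[∂_μ Y^μ V'] - ∂_μ T[Y^μ V']`. -/
def obs (o : ObsTable M) (i j : Fin 3) (Y : Fin 4 → Wick M) (V : Wick M) : Wick M :=
  Tprod o i j (∑ μ, D i μ (Y μ)) V - ∑ μ, D i μ (Tprod o i j (Y μ) V)

/-- The symmetrized obstruction map `𝔖_{xx'} O_{Y δ_{xx'}}(V'')`, for a Wick polynomial `Y` at `x`,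
i.e. one half of `T[((∂+∂')_μ (Y^μ δ_{xx'})) V''] - (∂+∂')_μ T[Y^μ δ_{xx'} V'']`.
Undifferentiated delta functions `δ_{xx'}` are taken out of the time-ordered product, where
`(∂+∂')_μ (Y^μ δ_{xx'}) = (∂_μ Y^μ) δ_{xx'}`. -/
def symObs (o : ObsTable M) (Y : Fin 4 → Wick M) (V : Wick M) : Wick M :=
  C (1 / 2) * (dlt 0 1 * Tprod o 0 2 (∑ μ, D 0 μ (Y μ)) V
    - ∑ μ, (D 0 μ (dlt 0 1 * Tprod o 0 2 (Y μ) V) + D 1 μ (dlt 0 1 * Tprod o 0 2 (Y μ) V)))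

/-! ### The interactions -/

/-- Lie-algebra valued Wick polynomials, by components. -/
abbrev LieW (M : Model) := Fin M.N → Wick M

/-- The bracket `i[Y, Z]`, with components `-f_{abc} Y_a Z_b`. -/
def br (Y Z : LieW M) : LieW M := fun c => -∑ a, ∑ b, C (M.f a b c : ℂ) * Y a * Z b

/-- The inner product `⟨Y | Z⟩`. -/
def ip (Y Z : LieW M) : Wick M := ∑ a, Y a * Z a

/-- `A_μ(x i)` -/
def A (i : Fin 3) (μ : Fin 4) : LieW M := fun a => fld i (.A a μ) 0
/-- `A^μ(x i)` -/
def Aup (i : Fin 3) (μ : Fin 4) : LieW M := fun a => C (g μ) * A i μ a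
/-- `F^{μν}(x i)` -/
def Fup (i : Fin 3) (μ ν : Fin 4) : LieW M := fun a => C (g μ * g ν) * fld i (.F a μ ν) 0
/-- `w(x i)` -/
def w (i : Fin 3) : LieW M := fun a => fld i (.w a) 0

/-- The quark current `j^μ_a = ψ̄ γ^μ π(ξ_a) ψ`. -/
def cur (i : Fin 3) (μ : Fin 4) : LieW M := fun a =>
  ∑ s, ∑ s', ∑ m, ∑ n, C (M.γ μ s s' * M.t a m n) * X (Gen.bil ⟨i, s, m, 0⟩ ⟨i, s', n, 0⟩)

/-- `L_1 = ½ ⟨F^{μν} | i[A_μ, A_ν]⟩ + ⟨A_μ | j^μ⟩`. -/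
def L1 (i : Fin 3) : Wick M :=
  C (1 / 2) * ∑ μ, ∑ ν, ip (Fup i μ ν) (br (A i μ) (A i ν)) + ∑ μ, ip (A i μ) (cur i μ)

/-- `∂Q_1^μ / ∂w = j^μ - i[F^{μν}, A_ν]`. -/
def J (i : Fin 3) (μ : Fin 4) : LieW M := cur i μ - ∑ ν, br (Fup i μ ν) (A i ν)

/-- `Q_1^μ = ⟨F^{μν} | i[w, A_ν]⟩ + ⟨w | j^μ⟩`. -/
def Q1 (i : Fin 3) (μ : Fin 4) : Wick M :=
  ∑ ν, ip (Fup i μ ν) (br (w i) (A i ν)) + ip (w i) (cur i μ)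

/-- `L_2 = -½ (1+c_F) ⟨i[A^μ, A^ν] | i[A_μ, A_ν]⟩`. -/
def L2 (i : Fin 3) : Wick M :=
  C (-(1 / 2) * (1 + (M.cF : ℂ))) *
    ∑ μ, ∑ ν, ip (br (Aup i μ) (Aup i ν)) (br (A i μ) (A i ν))

/-- The coefficient `-2 (1+c_F) ⟨i[A^μ, A^ν] | i[w, A_ν]⟩` of `δ_{xx'}` in `Q_2^μ|_δ`. -/
def Q2delta (i : Fin 3) (μ : Fin 4) : Wick M :=
  C (-2 * (1 + (M.cF : ℂ))) * ∑ ν, ip (br (Aup i μ) (Aup i ν)) (br (w i) (A i ν))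

/-- `w_2(x,x') = i[w', A'_ν] I^ν δ_{xx'}`.  The remaining part of `Q_2^μ(x;x')` is `2 ⟨J^μ(x) | w_2(x,x')⟩`. -/
def w2 : LieW M := fun a =>
  ∑ ν, br (w 1) (A 1 ν) a * ker 0 1 Base.delta (X (KOp.s ν))

/-- `O_{J_a(x)}(L_1(x''))`.  The second term is the contribution of the contractions of quark
fields in `⟨A''_κ | j''^κ⟩`, by the Ward identity `O_{j_a}(j''^κ_b) = -f_{abc} j^κ_c iδ`. -/
def obsJ (a : Fin M.N) : Wick M :=
  obs (oFull M) 0 2 (fun μ => J 0 μ a) (L1 2)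
    + ∑ b, ∑ c, ∑ κ, C (-(M.f a b c : ℂ)) * A 2 κ b * cur 0 κ c * idlt 0 2 1

/-! ### The third-order obstruction

The time-ordered products `T[P L_1(x'')]` of kernels `P(x,x')` that contain string-integrated delta
functions are not fixed by the two-point obstructions.  Below, `T2` is a prescription for them. -/

/-- `⟨∂Q_2/∂w_2 | O(w_2, L_1'')⟩` -/
def remainFirst (T2 : Wick M →ₗ[ℂ] Wick M) : Wick M :=
  ∑ μ, ∑ a, C 2 * J 0 μ a * (T2 (D 0 μ (w2 a)) - D 0 μ (T2 (w2 a)))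

/-- `O_{Q_2|_δ}(L_1'')|_{Iδ}`, symmetrized in `x`, `x'` -/
def remainSecond (M : Model) : Wick M := symObs (oString M) (Q2delta 0) (L1 2)

/-- `𝔖_{xx'x''} [⟨∂Q_2/∂w_2 | O(w_2, L_1'')⟩ + O_{Q_2|_δ}(L_1'')|_{Iδ}]` -/
def O3remain (T2 : Wick M →ₗ[ℂ] Wick M) : Wick M :=
  sym3 (remainFirst T2 + remainSecond M)

/-- `O_{Q_1}(L_2')|_δ δ_{x'x''} + O_{Q_2|_δ}(L_1'')|_δ` -/
def O3loc (M : Model) : Wick M :=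
  obs (oDelta M) 0 1 (Q1 0) (L2 1) * dlt 1 2 + symObs (oDelta M) (Q2delta 0) (L1 2)

/-- `𝔖_{xx'x''} [⟨w_2 | O(∂Q_2/∂w_2, L_1'')⟩ + O_{Q_1}(L_2')|_{Iδ} δ_{x'x''}]` -/
def O3w2 (M : Model) : Wick M :=
  sym3 (∑ a, C 2 * w2 a * obsJ a + obs (oString M) 0 1 (Q1 0) (L2 1) * dlt 1 2)

/-- The third-order obstruction
`O^{(3)} = 3 𝔖_{xx'x''} (O_{Q_1}(L_2') δ_{x'x''} + O_{Q_2(x;x')}(L_1''))`. -/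
def O3 (T2 : Wick M →ₗ[ℂ] Wick M) : Wick M :=
  C 3 * sym3 (obs (oFull M) 0 1 (Q1 0) (L2 1) * dlt 1 2
    + symObs (oFull M) (Q2delta 0) (L1 2)
    + remainFirst T2 + ∑ a, C 2 * w2 a * obsJ a)

end

/-- The string variation `δ_c` of Wick polynomials: `δ_c A_μ = ∂_μ w`, while `F` and the quark fields
are string-independent. -/
def deltaC (M : Model) : Derivation ℂ (Wick M) (Wick M) :=
  mkDerivation ℂ fun G : Gen M.N M.r => match G with
    | .field k (.A a μ) α => X (Gen.field k (.w a) (α + e1 μ))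
    | _ => 0

/-- Resolution of a third-order obstruction, modulo `I`, by `L_3` (at `x`) and `Q_3`:
`O^{(3)} = δ_c L_3 δ_{xx'x''} - 𝔖_{xx'x''} ∂_μ Q_3^μ(x;x',x'')`. -/
def Resolves {M : Model} (I : Ideal (Wick M)) (O L3 : Wick M) (Q3 : Fin 4 → Wick M) : Prop :=
  O - (deltaC M L3 * (dlt 0 1 * dlt 1 2) - sym3 (∑ μ, D 0 μ (Q3 μ))) ∈ I

end SQCD

end

noncomputable section

namespace SQCD

section
variable {M : Model}

/-! ### Kernels and derivatives -/

/-! The commutator of a derivative with a tree-level time-ordered product is, by the Leibniz rule, a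
sum of single contractions in which the propagator is replaced by the two-point obstruction
(`obs_eq`). Everything therefore reduces to first variations: of `L1` with respect to `A_κ`, which
gives the current `Jsym`, and with respect to `F`, which gives `[A_κ, A_λ]`; of `L2`, which gives
the triple bracket `cubic`; and of `Q1` and `Q2delta`.

Without string integrations, every surviving term has the form `⟨w | [A^ν, [A^λ, [A_ν, A_λ]]]⟩` once
the fields have been moved to one point by the delta function. By the Jacobi identity the two outer
brackets commute when they act on `[A_ν, A_λ]`, so the expression is antisymmetric in the contracted
indices and vanishes (`sum_ip_cubic`, `contrQ2_br`).

With string integrations, `O_{Q_1}(L_2')` contributes an axiality violation from the `F`–`A`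
obstruction, and the `A`–`A` obstruction, symmetric in `μ, ν`, contracted with the antisymmetric
`F^{μν}`. For `O_{Q_2|_δ}(L_1'')` the matrix inserted for `A_ν` is `stringS μ ν + η_{μν} stringV`.
The off-diagonal part of `stringS` contracts some `I'` with `A`, and the bracket term of `stringV`
contracts some `I` with `A`. The trace of `stringS` gives `3 I_κ`, because `I'^μ ∂_μ = 1`; it
cancels against `-3 I_κ` from the diagonal part. What remains is `3/4 (II') ∂_κ δ` times the current
at `x''` (`obs_Q2delta_oString`). That current is conserved by the field equations
(`sum_D_Jsym_mem_onShell`), so this is the divergence of `remainFlow` with respect to `x''`.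

For a sharp string, `I^μ = e^μ I_e` and `e^μ A_μ = 0` annihilate every axiality violation, and `w2`
with them. Only the divergence of `remainFlow` survives in the third-order obstruction. Under
symmetrization its derivative can be moved to the point `x`, which yields `Q_3` with `L_3 = 0`. -/

theorem ker_monomial (i j : Fin 3) (b : Base) (m : KOp →₀ ℕ) :
    (ker i j b (monomial m 1) : Wick M) = X (Gen.kern i j b m) := by
  have := (MvPolynomial.basisMonomials KOp ℂ).constr_basis ℂ
    (fun m => (X (Gen.kern i j b m) : Wick M)) m
  simpa [ker] using this

/-- Linear maps out of the kernels agree if they agree on monomials. -/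
theorem KPoly.linearMap_ext {P Q : KPoly →ₗ[ℂ] Wick M}
    (h : ∀ m, P (monomial m 1) = Q (monomial m 1)) : P = Q :=
  (MvPolynomial.basisMonomials KOp ℂ).ext fun m => by simpa using h m

theorem ker_C_mul (i j : Fin 3) (b : Base) (c : ℂ) (p : KPoly) :
    (ker i j b (C c * p) : Wick M) = C c * ker i j b p := by
  rw [← smul_eq_C_mul, map_smul, smul_eq_C_mul]

theorem idlt_C_mul (i j : Fin 3) (c : ℂ) (p : KPoly) :
    (idlt i j (C c * p) : Wick M) = C c * idlt i j p := by
  simp only [idlt, ker_C_mul]; ring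

theorem idlt_add (i j : Fin 3) (p q : KPoly) :
    (idlt i j (p + q) : Wick M) = idlt i j p + idlt i j q := by
  simp only [idlt, map_add]; ring

theorem idlt_neg (i j : Fin 3) (p : KPoly) : (idlt i j (-p) : Wick M) = -idlt i j p := by
  simp only [idlt, map_neg]; ring

theorem idlt_sub (i j : Fin 3) (p q : KPoly) :
    (idlt i j (p - q) : Wick M) = idlt i j p - idlt i j q := by
  simp only [idlt, map_sub]; ring

theorem idlt_zero (i j : Fin 3) : (idlt i j 0 : Wick M) = 0 := by simp [idlt]

theorem idlt_C (i j : Fin 3) (c : ℂ) :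
    (idlt i j (C c) : Wick M) = C (c * Complex.I) * dlt i j := by
  rw [← mul_one (C c), idlt_C_mul, idlt, dlt, ← mul_assoc, ← C_mul]

theorem idlt_sum {ι : Type*} (s : Finset ι) (i j : Fin 3) (p : ι → KPoly) :
    (idlt i j (∑ n ∈ s, p n) : Wick M) = ∑ n ∈ s, idlt i j (p n) := by
  simp only [idlt, map_sum, Finset.mul_sum]

@[simp] theorem D_C (i : Fin 3) (μ : Fin 4) (c : ℂ) : D (M := M) i μ (C c) = 0 :=
  (D i μ).map_algebraMap c

theorem D_C_mul (i : Fin 3) (μ : Fin 4) (c : ℂ) (P : Wick M) :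
    D i μ (C c * P) = C c * D i μ P := by
  rw [← smul_eq_C_mul, (D i μ).map_smul, smul_eq_C_mul]

theorem D_fld (i j : Fin 3) (μ : Fin 4) (φ : GluonField M.N) (α : Jet) :
    D i μ (fld (M := M) j φ α) = if j = i then fld j φ (α + e1 μ) else 0 := by
  simp [D, fld, mkDerivation_X]

theorem D_bil (i : Fin 3) (μ : Fin 4) (p q : QuarkJet M.r) :
    D i μ (X (Gen.bil p q) : Wick M) =
      (if p.point = i then X (Gen.bil { p with jet := p.jet + e1 μ } q) else 0)
        + (if q.point = i then X (Gen.bil p { q with jet := q.jet + e1 μ }) else 0) := by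
  simp [D, mkDerivation_X]

/-- A kernel depends on the difference of its two points, hence the opposite signs, and derivatives
commute with string operations, hence the multiplication by `pd μ`. Both sides are linear in `p`, so
it suffices to compare them on monomials. -/
theorem D_ker (i j k : Fin 3) (b : Base) (μ : Fin 4) (p : KPoly) :
    D i μ (ker j k b p : Wick M) =
      (if j = i then ker j k b (p * pd μ) else 0) - (if k = i then ker j k b (p * pd μ) else 0) := by
  let R : KPoly →ₗ[ℂ] Wick M := (ker j k b) ∘ₗ LinearMap.mulRight ℂ (pd μ)
  have h : ((D i μ : Derivation ℂ (Wick M) (Wick M)) : Wick M →ₗ[ℂ] Wick M) ∘ₗ ker j k b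
      = (if j = i then R else 0) - (if k = i then R else 0) := by
    refine KPoly.linearMap_ext fun m => ?_
    have hm : R (monomial m 1) = X (Gen.kern j k b (m + Finsupp.single (KOp.d μ) 1)) := by
      simp only [R, LinearMap.comp_apply, LinearMap.mulRight_apply, pd]
      rw [X, monomial_mul, one_mul, ker_monomial]
    have hl : ((D i μ : Derivation ℂ (Wick M) (Wick M)) : Wick M →ₗ[ℂ] Wick M)
        (ker j k b (monomial m 1)) = (if j = i then R (monomial m 1) else 0)
          - (if k = i then R (monomial m 1) else 0) := by
      rw [ker_monomial, hm]; simp [D, mkDerivation_X]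
    rw [LinearMap.comp_apply, hl]
    split_ifs <;> simp
  have := LinearMap.congr_fun h p
  simp only [LinearMap.comp_apply] at this
  refine this.trans ?_
  split_ifs <;> simp [R]

theorem D_idlt (i j k : Fin 3) (μ : Fin 4) (p : KPoly) :
    D i μ (idlt j k p : Wick M) =
      (if j = i then idlt j k (p * pd μ) else 0) - (if k = i then idlt j k (p * pd μ) else 0) := by
  rw [idlt, D_C_mul, D_ker]
  split_ifs <;> simp [idlt]

/-! ### Permutations of the points -/

/-- The renaming of the three points of a Wick polynomial. -/
def permW (σ : Equiv.Perm (Fin 3)) : Wick M →ₐ[ℂ] Wick M := rename (Gen.perm σ)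

theorem permW_C (σ : Equiv.Perm (Fin 3)) (c : ℂ) : permW σ (C c : Wick M) = C c := by
  simp [permW]

theorem permW_fld (σ : Equiv.Perm (Fin 3)) (i : Fin 3) (φ : GluonField M.N) (α : Jet) :
    permW σ (fld (M := M) i φ α) = fld (σ i) φ α := by
  simp [permW, fld, Gen.perm]

theorem permW_bil (σ : Equiv.Perm (Fin 3)) (p q : QuarkJet M.r) :
    permW σ (X (Gen.bil p q) : Wick M)
      = X (Gen.bil { p with point := σ p.point } { q with point := σ q.point }) := by
  simp [permW, Gen.perm]

theorem permW_kern (σ : Equiv.Perm (Fin 3)) (i j : Fin 3) (b : Base) (m : KOp →₀ ℕ) :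
    permW σ (X (Gen.kern i j b m) : Wick M) = X (Gen.kern (σ i) (σ j) b m) := by
  simp [permW, Gen.perm]

theorem permW_ker (σ : Equiv.Perm (Fin 3)) (i j : Fin 3) (b : Base) (p : KPoly) :
    permW σ (ker i j b p : Wick M) = ker (σ i) (σ j) b p := by
  have h : (permW σ : Wick M →ₐ[ℂ] Wick M).toLinearMap ∘ₗ ker i j b = ker (σ i) (σ j) b :=
    KPoly.linearMap_ext fun m => by simp [ker_monomial, permW_kern]
  exact LinearMap.congr_fun h p

theorem permW_dlt (σ : Equiv.Perm (Fin 3)) (i j : Fin 3) :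
    permW σ (dlt i j : Wick M) = dlt (σ i) (σ j) := permW_ker ..

theorem permW_idlt (σ : Equiv.Perm (Fin 3)) (i j : Fin 3) (p : KPoly) :
    permW σ (idlt i j p : Wick M) = idlt (σ i) (σ j) p := by
  simp [idlt, permW_ker]

theorem permW_D (σ : Equiv.Perm (Fin 3)) (i : Fin 3) (μ : Fin 4) (P : Wick M) :
    permW σ (D i μ P) = D (σ i) μ (permW σ P) := by
  induction P using MvPolynomial.induction_on with
  | C a => simp
  | add p q hp hq => simp [hp, hq]
  | mul_X p G hp =>
    have hG : permW σ (D i μ (X G : Wick M)) = D (σ i) μ (permW σ (X G)) := by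
      match G with
      | .field k φ α =>
        change permW σ (D i μ (fld k φ α)) = D (σ i) μ (permW σ (fld k φ α))
        simp only [D_fld, permW_fld, EmbeddingLike.apply_eq_iff_eq, apply_ite (permW σ), map_zero]
      | .bil p q =>
        simp only [D_bil, permW_bil, EmbeddingLike.apply_eq_iff_eq, apply_ite (permW σ), map_zero,
          map_add]
      | .kern j k b m =>
        simp only [← ker_monomial, D_ker, permW_ker, EmbeddingLike.apply_eq_iff_eq,
          apply_ite (permW σ), map_zero, map_sub]
    simp only [Derivation.leibniz, map_mul, map_add, smul_eq_mul, hp, hG]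

theorem sym3_eq (P : Wick M) : sym3 P = C (1 / 6) * ∑ σ, permW σ P := rfl

theorem sym3_add (P Q : Wick M) : sym3 (P + Q) = sym3 P + sym3 Q := by
  simp only [sym3_eq, map_add, Finset.sum_add_distrib, mul_add]

theorem sym3_sub (P Q : Wick M) : sym3 (P - Q) = sym3 P - sym3 Q := by
  simp only [sym3_eq, map_sub, Finset.sum_sub_distrib, mul_sub]

theorem sym3_C_mul (c : ℂ) (P : Wick M) : sym3 (C c * P) = C c * sym3 P := by
  simp only [sym3_eq, map_mul, permW_C, Finset.mul_sum]
  exact Finset.sum_congr rfl fun σ _ => by ring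

theorem permW_mul_apply (σ τ : Equiv.Perm (Fin 3)) (P : Wick M) :
    permW (σ * τ) P = permW σ (permW τ P) := by
  have h : Gen.perm (N := M.N) (r := M.r) (σ * τ) = Gen.perm σ ∘ Gen.perm τ := by
    funext G; cases G <;> rfl
  simp only [permW, rename_rename, h]

/-- Reindexing of the average by right multiplication with `τ`. This is what allows a derivative at
one point to be traded for a derivative at another one under symmetrization. -/
theorem sym3_permW (τ : Equiv.Perm (Fin 3)) (P : Wick M) : sym3 (permW τ P) = sym3 P := by
  simp only [sym3_eq, ← permW_mul_apply]
  rw [Fintype.sum_equiv (Equiv.mulRight τ) (fun σ => permW (σ * τ) P) (fun σ => permW σ P)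
    fun σ => rfl]

/-! ### Differential ideals -/

theorem subset_diffIdeal (S : Set (Wick M)) : S ⊆ diffIdeal S := fun _ hP =>
  Ideal.mem_sInf.2 fun {_} hJ => hJ.1 hP

theorem D_mem_diffIdeal {S : Set (Wick M)} (i : Fin 3) (μ : Fin 4) {P : Wick M}
    (hP : P ∈ diffIdeal S) : D i μ P ∈ diffIdeal S :=
  Ideal.mem_sInf.2 fun {_} hJ => hJ.2 i μ P (Ideal.mem_sInf.1 hP hJ)

theorem diffIdeal_le {S : Set (Wick M)} {J : Ideal (Wick M)} (hS : S ⊆ J)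
    (hD : ∀ i μ, ∀ P ∈ J, D i μ P ∈ J) : diffIdeal S ≤ J :=
  sInf_le ⟨hS, hD⟩

/-- Renaming intertwines `D i μ` with `D (σ i) μ`, so the preimage of the differential ideal under
the renaming is itself stable under all derivatives; minimality of `diffIdeal S` does the rest. -/
theorem permW_mem_diffIdeal {S : Set (Wick M)} (σ : Equiv.Perm (Fin 3))
    (hS : ∀ P ∈ S, permW σ P ∈ S) {P : Wick M} (hP : P ∈ diffIdeal S) :
    permW σ P ∈ diffIdeal S := by
  have : diffIdeal S ≤ (diffIdeal S).comap (permW σ : Wick M →ₐ[ℂ] Wick M) := by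
    refine diffIdeal_le (fun P hP => subset_diffIdeal S (hS P hP)) fun i μ P hP => ?_
    rw [Ideal.mem_comap] at hP ⊢
    rw [permW_D]
    exact D_mem_diffIdeal _ _ hP
  exact this hP

theorem Rel.permW {P : Wick M} (σ : Equiv.Perm (Fin 3)) (h : Rel M P) : Rel M (permW σ P) := by
  cases h with
  | curl i a μ ν α => simpa [permW_fld] using Rel.curl (σ i) a μ ν α
  | divF i a ν α => simpa [permW_fld, permW_C] using Rel.divF (σ i) a ν α
  | divA i a α => simpa [permW_fld, permW_C] using Rel.divA (σ i) a α
  | boxw i a α => simpa [permW_fld, permW_C] using Rel.boxw (σ i) a α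
  | dirac p i s n α =>
    simpa [permW_bil, permW_C] using Rel.dirac { p with point := σ p.point } (σ i) s n α
  | dirac' q i s n α =>
    simpa [permW_bil, permW_C] using Rel.dirac' { q with point := σ q.point } (σ i) s n α
  | pauli p q p' q' =>
    simpa [permW_bil] using Rel.pauli (M := M) { p with point := σ p.point }
      { q with point := σ q.point } { p' with point := σ p'.point } { q' with point := σ q'.point }
  | string i j b p => simpa only [permW_ker] using Rel.string (σ i) (σ j) b p
  | string' i j b p => simpa only [permW_ker] using Rel.string' (σ i) (σ j) b p
  | boxT i j p => simpa only [map_add, permW_ker, permW_idlt] using Rel.boxT (σ i) (σ j) p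
  | swap i j b m =>
    simpa only [map_sub, map_mul, permW_C, permW_kern] using Rel.swap (σ i) (σ j) b m
  | loc i j h φ α =>
    simpa only [map_sub, map_mul, permW_dlt, permW_fld] using
      Rel.loc (σ i) (σ j) (σ.injective.ne h) φ α
  | locbil i j h s n α q =>
    simpa only [map_sub, map_mul, permW_dlt, permW_bil] using
      Rel.locbil (σ i) (σ j) (σ.injective.ne h) s n α { q with point := σ q.point }
  | locbil' i j h s n α p =>
    simpa only [map_sub, map_mul, permW_dlt, permW_bil] using
      Rel.locbil' (σ i) (σ j) (σ.injective.ne h) s n α { p with point := σ p.point }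
  | locker i j k h hi hj b p =>
    simpa only [map_sub, map_mul, permW_dlt, permW_ker] using
      Rel.locker (σ i) (σ j) (σ k) (σ.injective.ne h) (σ.injective.ne hi) (σ.injective.ne hj) b p

theorem SharpRel.permW {e : Fin 4 → ℝ} {P : Wick M} (σ : Equiv.Perm (Fin 3))
    (h : SharpRel M e P) : SharpRel M e (permW σ P) := by
  cases h with
  | axial i a α => simpa [permW_fld, permW_C] using SharpRel.axial (e := e) (σ i) a α
  | dir i j b p μ => simpa only [permW_ker] using SharpRel.dir (e := e) (σ i) (σ j) b p μ
  | dir' i j b p μ => simpa only [permW_ker] using SharpRel.dir' (e := e) (σ i) (σ j) b p μ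

theorem Rel.mem_onShell {P : Wick M} (h : Rel M P) : P ∈ onShell M := subset_diffIdeal _ h

theorem SharpRel.mem_onShellSharp {e : Fin 4 → ℝ} {P : Wick M} (h : SharpRel M e P) :
    P ∈ onShellSharp M e := subset_diffIdeal _ (Or.inr h)

theorem onShell_le_onShellSharp (e : Fin 4 → ℝ) : onShell M ≤ onShellSharp M e :=
  diffIdeal_le (fun _ hP => subset_diffIdeal _ (Or.inl hP)) fun _ _ _ hP => D_mem_diffIdeal _ _ hP

theorem permW_mem_onShellSharp {e : Fin 4 → ℝ} (σ : Equiv.Perm (Fin 3)) {P : Wick M}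
    (hP : P ∈ onShellSharp M e) : permW σ P ∈ onShellSharp M e :=
  permW_mem_diffIdeal σ (fun _ h => h.imp (Rel.permW σ) (SharpRel.permW σ)) hP

theorem sym3_mem_onShellSharp {e : Fin 4 → ℝ} {P : Wick M}
    (hP : P ∈ onShellSharp M e) : sym3 P ∈ onShellSharp M e :=
  Ideal.mul_mem_left _ _ (Ideal.sum_mem _ fun σ _ => permW_mem_onShellSharp σ hP)

/-! ### Axiality -/

/-- With `q = e_ν I^ν`, the string `I^μ` equals `(I^μ + e^μ q) - e^μ q`: the first part vanishes by
the direction relation, the second one is `q` times `e^μ A_μ = 0`. Axiality holds at every point, so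
`k` is unrestricted. -/
theorem sum_s_mul_mem_onShellSharp {e : Fin 4 → ℝ} (i j k : Fin 3) (b : Base) (a : Fin M.N)
    (p : KPoly) :
    ∑ μ, ker i j b (p * X (KOp.s μ)) * fld k (.A a μ) 0 ∈ onShellSharp M e := by
  set q : KPoly := ∑ ν, C (g ν * (e ν : ℂ)) * X (KOp.s ν)
  have h : ∑ μ, ker i j b (p * X (KOp.s μ)) * fld k (.A a μ) 0
      = ∑ μ, ker i j b (p * (X (KOp.s μ) + C (e μ : ℂ) * q)) * fld k (.A a μ) 0
        - ker i j b (p * q) * ∑ μ, C (e μ : ℂ) * fld k (.A a μ) 0 := by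
    rw [Finset.mul_sum, ← Finset.sum_sub_distrib]
    refine Finset.sum_congr rfl fun μ _ => ?_
    rw [mul_add, map_add, mul_left_comm p (C _) q, ker_C_mul]
    ring
  rw [h]
  exact sub_mem (sum_mem fun μ _ => Ideal.mul_mem_right _ _ (SharpRel.dir i j b p μ).mem_onShellSharp)
    (Ideal.mul_mem_left _ _ (SharpRel.axial k a 0).mem_onShellSharp)

theorem sum_s'_mul_mem_onShellSharp {e : Fin 4 → ℝ} (i j k : Fin 3) (b : Base) (a : Fin M.N)
    (p : KPoly) :
    ∑ μ, ker i j b (p * X (KOp.s' μ)) * fld k (.A a μ) 0 ∈ onShellSharp M e := by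
  set q : KPoly := ∑ ν, C (g ν * (e ν : ℂ)) * X (KOp.s' ν)
  have h : ∑ μ, ker i j b (p * X (KOp.s' μ)) * fld k (.A a μ) 0
      = ∑ μ, ker i j b (p * (X (KOp.s' μ) + C (e μ : ℂ) * q)) * fld k (.A a μ) 0
        - ker i j b (p * q) * ∑ μ, C (e μ : ℂ) * fld k (.A a μ) 0 := by
    rw [Finset.mul_sum, ← Finset.sum_sub_distrib]
    refine Finset.sum_congr rfl fun μ _ => ?_
    rw [mul_add, map_add, mul_left_comm p (C _) q, ker_C_mul]
    ring
  rw [h]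
  exact sub_mem
    (sum_mem fun μ _ => Ideal.mul_mem_right _ _ (SharpRel.dir' i j b p μ).mem_onShellSharp)
    (Ideal.mul_mem_left _ _ (SharpRel.axial k a 0).mem_onShellSharp)

theorem axialityViolations_le_onShellSharp (e : Fin 4 → ℝ) :
    axialityViolations M ≤ onShellSharp M e := by
  refine Ideal.span_le.2 ?_
  rintro P ⟨i, j, k, a, p, -, -, rfl | rfl⟩
  · exact sum_s_mul_mem_onShellSharp (e := e) i j k Base.delta a p
  · exact sum_s'_mul_mem_onShellSharp (e := e) i j k Base.delta a p

theorem sum_s_mul_mem_axialityViolations {i j k : Fin 3} (hij : i ≠ j) (hk : k = i ∨ k = j)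
    (a : Fin M.N) (p : KPoly) :
    ∑ μ, ker i j Base.delta (p * X (KOp.s μ)) * fld k (.A a μ) 0 ∈ axialityViolations M :=
  Ideal.subset_span ⟨i, j, k, a, p, hij, hk, Or.inl rfl⟩

theorem sum_s'_mul_mem_axialityViolations {i j k : Fin 3} (hij : i ≠ j) (hk : k = i ∨ k = j)
    (a : Fin M.N) (p : KPoly) :
    ∑ μ, ker i j Base.delta (p * X (KOp.s' μ)) * fld k (.A a μ) 0 ∈ axialityViolations M :=
  Ideal.subset_span ⟨i, j, k, a, p, hij, hk, Or.inr rfl⟩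

/-! ### Total derivatives -/

theorem permW_mem_stringLocal (σ : Equiv.Perm (Fin 3)) {P : Wick M} (hP : P ∈ stringLocal M) :
    permW σ P ∈ stringLocal M := by
  classical
  rw [stringLocal, mem_supported] at hP ⊢
  intro G hG
  obtain ⟨G', hG', rfl⟩ := Finset.mem_image.1 (vars_rename _ _ hG)
  have := hP hG'
  match G', this with
  | .field .., _ => trivial
  | .bil .., _ => trivial
  | .kern _ _ .delta _, h => exact h

theorem fld_mem_stringLocal (i : Fin 3) (φ : GluonField M.N) (α : Jet) :
    fld i φ α ∈ stringLocal M := by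
  rw [fld, stringLocal, X_mem_supported]; trivial

theorem bil_mem_stringLocal (p q : QuarkJet M.r) : X (Gen.bil p q) ∈ stringLocal M := by
  rw [stringLocal, X_mem_supported]; trivial

theorem C_mem_stringLocal (c : ℂ) : C c ∈ stringLocal M := (stringLocal M).algebraMap_mem c

theorem dlt_mem_stringLocal (i j : Fin 3) : dlt i j ∈ stringLocal M := by
  rw [dlt, ← MvPolynomial.C_1, C_apply, ker_monomial, stringLocal, X_mem_supported]
  intro κ ν; simp

theorem ker_stst_mem_stringLocal (i j : Fin 3) : ker i j .delta stst ∈ stringLocal M := by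
  rw [stst, map_sum]
  refine sum_mem fun μ _ => ?_
  rw [st', mul_left_comm, ker_C_mul]
  refine mul_mem (C_mem_stringLocal _) ?_
  rw [X, X, monomial_mul, one_mul, ker_monomial, stringLocal, X_mem_supported]
  intro κ ν; simp

theorem IsTotalDerivative.of_mem {J : Ideal (Wick M)} {P : Wick M} (h : P ∈ J) :
    IsTotalDerivative J P :=
  ⟨0, fun _ _ => zero_mem _, by simpa using h⟩

theorem IsTotalDerivative.mono {J K : Ideal (Wick M)} {P : Wick M} (hJK : J ≤ K)
    (h : IsTotalDerivative J P) : IsTotalDerivative K P :=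
  let ⟨Q, hQ, hP⟩ := h; ⟨Q, hQ, hJK hP⟩

theorem IsTotalDerivative.add_mem {J : Ideal (Wick M)} {P R : Wick M}
    (h : IsTotalDerivative J P) (hR : R ∈ J) : IsTotalDerivative J (R + P) :=
  let ⟨Q, hQ, hP⟩ := h; ⟨Q, hQ, by simpa [add_sub_assoc] using J.add_mem hR hP⟩

theorem sym3_sum_D (Q : Fin 3 → Fin 4 → Wick M) :
    sym3 (∑ i, ∑ μ, D i μ (Q i μ))
      = ∑ i, ∑ μ, D i μ (C (1 / 6) * ∑ σ : Equiv.Perm (Fin 3), permW σ (Q (σ⁻¹ i) μ)) := by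
  have h : ∀ σ : Equiv.Perm (Fin 3), permW σ (∑ i, ∑ μ, D i μ (Q i μ))
      = ∑ i, ∑ μ, D i μ (permW σ (Q (σ⁻¹ i) μ)) := fun σ => by
    simp only [map_sum, permW_D]
    refine Fintype.sum_equiv σ (fun i => ∑ μ, D (σ i) μ (permW σ (Q i μ)))
      (fun i => ∑ μ, D i μ (permW σ (Q (σ⁻¹ i) μ))) fun i => ?_
    -- The permutation moves the derivative from `x i` to `x (σ i)`; the vector field is therefore
    -- read off at the preimage of the index.
    rw [show σ⁻¹ (σ i) = i from σ.symm_apply_apply i]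
  rw [sym3_eq, Finset.sum_congr rfl fun σ _ => h σ, Finset.sum_comm, Finset.mul_sum]
  refine Finset.sum_congr rfl fun i _ => ?_
  rw [Finset.sum_comm, Finset.mul_sum]
  refine Finset.sum_congr rfl fun μ _ => ?_
  rw [D_C_mul, map_sum]

theorem IsTotalDerivative.symmetrize {e : Fin 4 → ℝ} {P : Wick M}
    (h : IsTotalDerivative (onShellSharp M e) P) :
    IsTotalDerivative (onShellSharp M e) (sym3 P) := by
  obtain ⟨Q, hQ, hP⟩ := h
  refine ⟨fun i μ => C (1 / 6) * ∑ σ : Equiv.Perm (Fin 3), permW σ (Q (σ⁻¹ i) μ), fun i μ =>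
    mul_mem (C_mem_stringLocal _) (sum_mem fun σ _ => permW_mem_stringLocal σ (hQ _ _)), ?_⟩
  rw [← sym3_sum_D, ← sym3_sub]
  exact sym3_mem_onShellSharp hP

/-! ### Lie algebra valued Wick polynomials -/

theorem br_add_left (X Y Z : LieW M) : br (X + Y) Z = br X Z + br Y Z := by
  funext c
  simp only [br, Pi.add_apply, mul_add, add_mul, Finset.sum_add_distrib]; ring

theorem br_add_right (X Y Z : LieW M) : br X (Y + Z) = br X Y + br X Z := by
  funext c
  simp only [br, Pi.add_apply, mul_add, Finset.sum_add_distrib]; ring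

theorem br_smul_left (r : Wick M) (X Y : LieW M) : br (r • X) Y = r • br X Y := by
  funext c
  simp only [br, Pi.smul_apply, smul_eq_mul, mul_neg, Finset.mul_sum]
  refine congrArg Neg.neg ?_
  refine Finset.sum_congr rfl fun a _ => Finset.sum_congr rfl fun b _ => by ring

theorem br_smul_right (r : Wick M) (X Y : LieW M) : br X (r • Y) = r • br X Y := by
  funext c
  simp only [br, Pi.smul_apply, smul_eq_mul, mul_neg, Finset.mul_sum]
  refine congrArg Neg.neg ?_
  refine Finset.sum_congr rfl fun a _ => Finset.sum_congr rfl fun b _ => by ring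

theorem br_swap (X Y : LieW M) : br X Y = -br Y X := by
  funext c
  simp only [br, Pi.neg_apply, neg_neg]
  rw [Finset.sum_comm, ← Finset.sum_neg_distrib]
  refine Finset.sum_congr rfl fun a _ => ?_
  rw [← Finset.sum_neg_distrib]
  refine Finset.sum_congr rfl fun b _ => ?_
  rw [M.f_swap_left]
  push_cast
  rw [C_neg]; ring

/-- Antisymmetry gives `2 [X, X] = 0`, and `2` can be cancelled in the Wick algebra, a domain of
characteristic zero. -/
theorem br_self (X : LieW M) : br X X = 0 := by
  have h := br_swap X X
  funext c
  have hc := congrFun h c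
  rw [Pi.neg_apply, eq_neg_iff_add_eq_zero, ← two_mul] at hc
  exact (mul_eq_zero.1 hc).resolve_left two_ne_zero

theorem br_neg_left (X Y : LieW M) : br (-X) Y = -br X Y := by
  simpa using br_smul_left (-1) X Y

theorem br_neg_right (X Y : LieW M) : br X (-Y) = -br X Y := by
  simpa using br_smul_right (-1) X Y

theorem br_zero_left (X : LieW M) : br 0 X = 0 := by simpa using br_smul_left 0 0 X

theorem br_zero_right (X : LieW M) : br X 0 = 0 := by simpa using br_smul_right 0 X 0

theorem br_sum_left {ι : Type*} (s : Finset ι) (X : ι → LieW M) (Y : LieW M) :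
    br (∑ n ∈ s, X n) Y = ∑ n ∈ s, br (X n) Y :=
  map_sum (AddMonoidHom.mk' (fun X => br X Y) fun X X' => br_add_left X X' Y) X s

theorem br_sum_right {ι : Type*} (s : Finset ι) (X : LieW M) (Y : ι → LieW M) :
    br X (∑ n ∈ s, Y n) = ∑ n ∈ s, br X (Y n) :=
  map_sum (AddMonoidHom.mk' (fun Y => br X Y) fun Y Y' => br_add_right X Y Y') Y s

theorem ip_comm (X Y : LieW M) : ip X Y = ip Y X :=
  Finset.sum_congr rfl fun _ _ => mul_comm _ _

theorem ip_add_left (X Y Z : LieW M) : ip (X + Y) Z = ip X Z + ip Y Z := by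
  simp only [ip, Pi.add_apply, add_mul, Finset.sum_add_distrib]

theorem ip_add_right (X Y Z : LieW M) : ip X (Y + Z) = ip X Y + ip X Z := by
  simp only [ip, Pi.add_apply, mul_add, Finset.sum_add_distrib]

theorem ip_smul_left (r : Wick M) (X Y : LieW M) : ip (r • X) Y = r * ip X Y := by
  simp only [ip, Pi.smul_apply, smul_eq_mul, Finset.mul_sum, mul_assoc]

theorem ip_smul_right (r : Wick M) (X Y : LieW M) : ip X (r • Y) = r * ip X Y := by
  rw [ip_comm, ip_smul_left, ip_comm]

theorem ip_neg_left (X Y : LieW M) : ip (-X) Y = -ip X Y := by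
  simpa using ip_smul_left (-1) X Y

theorem ip_neg_right (X Y : LieW M) : ip X (-Y) = -ip X Y := by
  simpa using ip_smul_right (-1) X Y

theorem ip_zero_left (X : LieW M) : ip 0 X = 0 := by simp [ip]

theorem ip_zero_right (X : LieW M) : ip X 0 = 0 := by simp [ip]

theorem ip_sum_left {ι : Type*} (s : Finset ι) (X : ι → LieW M) (Y : LieW M) :
    ip (∑ n ∈ s, X n) Y = ∑ n ∈ s, ip (X n) Y :=
  map_sum (AddMonoidHom.mk' (fun X => ip X Y) fun X X' => ip_add_left X X' Y) X s

theorem ip_sum_right {ι : Type*} (s : Finset ι) (X : LieW M) (Y : ι → LieW M) :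
    ip X (∑ n ∈ s, Y n) = ∑ n ∈ s, ip X (Y n) :=
  map_sum (AddMonoidHom.mk' (fun Y => ip X Y) fun Y Y' => ip_add_right X Y Y') Y s

theorem f_cyclic (a b c : Fin M.N) : M.f b c a = M.f a b c := by
  rw [M.f_swap_right b a c, M.f_swap_left a b c, neg_neg]

/-- Invariance of the inner product. -/
theorem ip_br_left (X Y Z : LieW M) : ip (br X Y) Z = ip X (br Y Z) := by
  have h : ∀ X Y Z : LieW M, ip (br X Y) Z
      = -∑ a, ∑ b, ∑ c, C (M.f a b c : ℂ) * X a * Y b * Z c := fun X Y Z => by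
    simp only [ip, br, neg_mul, Finset.sum_neg_distrib, Finset.sum_mul]
    rw [Finset.sum_comm]
    exact congrArg Neg.neg (Finset.sum_congr rfl fun a _ => Finset.sum_comm)
  rw [h, ip_comm, h]
  refine congrArg Neg.neg (Eq.symm
    ((Finset.sum_congr rfl fun b _ => Finset.sum_comm).trans (Finset.sum_comm.trans ?_)))
  refine Finset.sum_congr rfl fun a _ => Finset.sum_congr rfl fun b _ =>
    Finset.sum_congr rfl fun c _ => ?_
  rw [f_cyclic]; ring

/-- The Jacobi identity. -/
theorem br_jacobi (X Y Z : LieW M) :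
    br X (br Y Z) + br Y (br Z X) + br Z (br X Y) = 0 := by
  have h : ∀ (X Y Z : LieW M) d, br X (br Y Z) d = ∑ a, ∑ b, ∑ c,
      C (∑ e, (M.f a e d : ℂ) * (M.f b c e : ℂ)) * (X a * Y b * Z c) := fun X Y Z d => by
    simp only [br, mul_neg, Finset.sum_neg_distrib, neg_neg, map_sum, Finset.mul_sum,
      Finset.sum_mul]
    refine Finset.sum_congr rfl fun a _ => ?_
    rw [Finset.sum_comm]
    refine Finset.sum_congr rfl fun b _ => ?_
    rw [Finset.sum_comm]
    refine Finset.sum_congr rfl fun c _ => Finset.sum_congr rfl fun e _ => ?_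
    rw [C_mul]; ring
  funext d
  simp only [Pi.add_apply, Pi.zero_apply, h]
  -- The three double brackets are brought to the same order of summation, so that the coefficients
  -- of each monomial `X a * Y b * Z c` can be collected.
  rw [Finset.sum_congr (g := fun b => ∑ a, ∑ c,
      C (∑ e, (M.f b e d : ℂ) * (M.f c a e : ℂ)) * (Y b * Z c * X a)) rfl
      fun b _ => Finset.sum_comm (f := fun c a => C (∑ e, (M.f b e d : ℂ) * (M.f c a e : ℂ))
        * (Y b * Z c * X a)),
    Finset.sum_comm (f := fun b a => ∑ c,
      C (∑ e, (M.f b e d : ℂ) * (M.f c a e : ℂ)) * (Y b * Z c * X a)),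
    Finset.sum_comm (f := fun c a => ∑ b,
      C (∑ e, (M.f c e d : ℂ) * (M.f a b e : ℂ)) * (Z c * X a * Y b)),
    ← Finset.sum_add_distrib, ← Finset.sum_add_distrib]
  refine Finset.sum_eq_zero fun a _ => ?_
  rw [Finset.sum_comm (f := fun c b =>
      C (∑ e, (M.f c e d : ℂ) * (M.f a b e : ℂ)) * (Z c * X a * Y b)),
    ← Finset.sum_add_distrib, ← Finset.sum_add_distrib]
  refine Finset.sum_eq_zero fun b _ => ?_
  rw [← Finset.sum_add_distrib, ← Finset.sum_add_distrib]
  refine Finset.sum_eq_zero fun c _ => ?_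
  -- This is minus the Jacobi identity of the model, after exchanging the first two indices of one
  -- structure constant in each product.
  have hJ : (∑ e, (M.f a e d : ℂ) * (M.f b c e : ℂ)) + (∑ e, (M.f b e d : ℂ) * (M.f c a e : ℂ))
      + (∑ e, (M.f c e d : ℂ) * (M.f a b e : ℂ)) = 0 := by
    have := congrArg (fun x : ℝ => (-x : ℂ)) (M.jacobi a b c d)
    simp only [Complex.ofReal_zero, neg_zero] at this
    rw [← this, ← Finset.sum_add_distrib, ← Finset.sum_add_distrib]
    push_cast
    rw [← Finset.sum_neg_distrib]
    refine Finset.sum_congr rfl fun e _ => ?_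
    rw [M.f_swap_left e a d, M.f_swap_left e b d, M.f_swap_left e c d]
    push_cast; ring
  calc _ = C ((∑ e, (M.f a e d : ℂ) * (M.f b c e : ℂ)) + (∑ e, (M.f b e d : ℂ) * (M.f c a e : ℂ))
      + (∑ e, (M.f c e d : ℂ) * (M.f a b e : ℂ))) * (X a * Y b * Z c) := by
        rw [C_add, C_add]; ring
    _ = 0 := by rw [hJ, C_0, zero_mul]

theorem ip_mem_left {J : Ideal (Wick M)} {X : LieW M} (hX : ∀ a, X a ∈ J) (Y : LieW M) :
    ip X Y ∈ J :=
  sum_mem fun a _ => J.mul_mem_right _ (hX a)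

theorem ip_mem_right {J : Ideal (Wick M)} (X : LieW M) {Y : LieW M} (hY : ∀ a, Y a ∈ J) :
    ip X Y ∈ J :=
  sum_mem fun a _ => J.mul_mem_left _ (hY a)

theorem br_mem_left {J : Ideal (Wick M)} {X : LieW M} (hX : ∀ a, X a ∈ J) (Y : LieW M)
    (c : Fin M.N) : br X Y c ∈ J :=
  neg_mem (sum_mem fun a _ => sum_mem fun _ _ => J.mul_mem_right _ (J.mul_mem_left _ (hX a)))

theorem br_mem_right {J : Ideal (Wick M)} (X : LieW M) {Y : LieW M} (hY : ∀ a, Y a ∈ J)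
    (c : Fin M.N) : br X Y c ∈ J :=
  neg_mem (sum_mem fun _ _ => sum_mem fun b _ => J.mul_mem_left _ (hY b))

/-! ### Derivations acting on Lie algebra valued polynomials -/

/-- The componentwise action of a derivation. -/
def mapLie (d : Derivation ℂ (Wick M) (Wick M)) (X : LieW M) : LieW M := fun a => d (X a)

theorem der_C_mul (d : Derivation ℂ (Wick M) (Wick M)) (c : ℂ) (P : Wick M) :
    d (C c * P) = C c * d P := by
  rw [← smul_eq_C_mul, d.map_smul, smul_eq_C_mul]

theorem der_ip (d : Derivation ℂ (Wick M) (Wick M)) (X Y : LieW M) :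
    d (ip X Y) = ip (mapLie d X) Y + ip X (mapLie d Y) := by
  simp only [ip, mapLie, map_sum, Derivation.leibniz, smul_eq_mul, Finset.sum_add_distrib]
  rw [add_comm]
  simp only [mul_comm]

theorem mapLie_br (d : Derivation ℂ (Wick M) (Wick M)) (X Y : LieW M) :
    mapLie d (br X Y) = br (mapLie d X) Y + br X (mapLie d Y) := by
  funext c
  simp only [mapLie, br, map_neg, map_sum, mul_assoc, der_C_mul, Pi.add_apply]
  simp only [Derivation.leibniz, smul_eq_mul, mul_add, Finset.sum_add_distrib]
  rw [neg_add, add_comm]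
  simp only [mul_comm (Y _)]

theorem mapLie_add (d : Derivation ℂ (Wick M) (Wick M)) (X Y : LieW M) :
    mapLie d (X + Y) = mapLie d X + mapLie d Y := by
  funext c; simp [mapLie]

theorem mapLie_sum {ι : Type*} (d : Derivation ℂ (Wick M) (Wick M)) (s : Finset ι)
    (X : ι → LieW M) : mapLie d (∑ n ∈ s, X n) = ∑ n ∈ s, mapLie d (X n) := by
  funext c; simp [mapLie]

theorem mapLie_C_smul (d : Derivation ℂ (Wick M) (Wick M)) (c : ℂ) (X : LieW M) :
    mapLie d ((C c : Wick M) • X) = (C c : Wick M) • mapLie d X := by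
  funext a; simp only [mapLie, Pi.smul_apply, smul_eq_mul, der_C_mul]

theorem Aup_eq (i : Fin 3) (μ : Fin 4) : (Aup i μ : LieW M) = (C (g μ) : Wick M) • A i μ := rfl

/-- The lower components `F_{μν}`. -/
def Fdn (i : Fin 3) (μ ν : Fin 4) : LieW M := fun a => fld i (.F a μ ν) 0

theorem Fup_eq (i : Fin 3) (μ ν : Fin 4) :
    (Fup i μ ν : LieW M) = (C (g μ * g ν) : Wick M) • Fdn i μ ν := rfl

/-! ### Wick contractions -/

/-- Rewrites the iterated sum over field components as one sum over a finite type, so that sums over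
fields can be interchanged and commuted with linear maps. -/
theorem sumAF_eq_sum : ∃ (ι : Type) (_ : Fintype ι) (u : ι → GluonField M.N),
    ∀ h : GluonField M.N → Wick M, sumAF h = ∑ x, h (u x) := by
  refine ⟨Fin M.N × (Fin 4 ⊕ Fin 4 × Fin 4), inferInstance, fun x => match x with
    | (a, .inl μ) => .A a μ
    | (a, .inr (μ, ν)) => .F a μ ν, fun h => ?_⟩
  simp only [sumAF, Fintype.sum_prod_type, Fintype.sum_sum_type]

theorem sumAFw_eq_sum : ∃ (ι : Type) (_ : Fintype ι) (u : ι → GluonField M.N),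
    ∀ h : GluonField M.N → Wick M, sumAFw h = ∑ x, h (u x) := by
  obtain ⟨ι, _, u, hu⟩ := sumAF_eq_sum (M := M)
  refine ⟨ι ⊕ Fin M.N, inferInstance, Sum.elim u .w, fun h => ?_⟩
  simp only [sumAFw, hu, Fintype.sum_sum_type, Sum.elim_inl, Sum.elim_inr]

/-- The derivation that replaces the undifferentiated gluon fields `φ` at `x i` by `h φ`. -/
def contr (i : Fin 3) (h : GluonField M.N → Wick M) : Derivation ℂ (Wick M) (Wick M) :=
  mkDerivation ℂ fun G : Gen M.N M.r => match G with
    | .field k φ α => open Classical in if k = i ∧ α = 0 then h φ else 0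
    | _ => 0

theorem contr_fld (i k : Fin 3) (h : GluonField M.N → Wick M) (φ : GluonField M.N) :
    contr i h (fld k φ 0) = if k = i then h φ else 0 := by
  simp [contr, fld, mkDerivation_X]

theorem contr_bil (i : Fin 3) (h : GluonField M.N → Wick M) (p q : QuarkJet M.r) :
    contr i h (X (Gen.bil p q)) = 0 := by
  simp [contr, mkDerivation_X]

theorem sumAFw_pderiv_X (i : Fin 3) (h : GluonField M.N → Wick M) (G : Gen M.N M.r) :
    sumAFw (fun φ => pderiv (Gen.field i φ 0) (X G) * h φ) = contr i h (X G) := by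
  classical
  simp only [pderiv_X, contr, mkDerivation_X, Pi.single_apply]
  match G with
  | .bil p q => simp [sumAFw, sumAF]
  | .kern j k b m => simp [sumAFw, sumAF]
  | .field k φ α =>
    by_cases hk : k = i
    · by_cases hα : α = 0
      · cases φ <;>
        simp [sumAFw, sumAF, hk, hα, ite_and, Finset.sum_ite_eq]
      · simp [sumAFw, sumAF, hα]
    · simp [sumAFw, sumAF, hk]

/-- The chain rule: both sides are derivations in `P`, so agreement on generators suffices. It turns
a Wick contraction into a derivation, to which the product rules for `ip` and `br` apply. -/
theorem sumAFw_pderiv (i : Fin 3) (h : GluonField M.N → Wick M) (P : Wick M) :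
    sumAFw (fun φ => pderiv (Gen.field i φ 0) P * h φ) = contr i h P := by
  have hX := sumAFw_pderiv_X (M := M) i h
  obtain ⟨ι, _, u, hu⟩ := sumAFw_eq_sum (M := M)
  simp only [hu] at hX ⊢
  induction P using MvPolynomial.induction_on with
  | C a => simp
  | add p q hp hq => simp only [map_add, add_mul, Finset.sum_add_distrib, hp, hq]
  | mul_X p G hp =>
    simp only [Derivation.leibniz, smul_eq_mul, ← hp, ← hX G, Finset.mul_sum, add_mul,
      Finset.sum_add_distrib, mul_assoc]

theorem sumAF_pderiv (i : Fin 3) (h : GluonField M.N → Wick M) (hw : ∀ a, h (.w a) = 0)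
    (P : Wick M) :
    sumAF (fun φ => pderiv (Gen.field i φ 0) P * h φ) = contr i h P := by
  rw [← sumAFw_pderiv, sumAFw]
  simp [hw]

theorem e1_inj {μ ν : Fin 4} : e1 μ = e1 ν ↔ μ = ν :=
  Finsupp.single_left_inj one_ne_zero

theorem add_e1_eq_e1 (α : Jet) (μ ν : Fin 4) : α + e1 μ = e1 ν ↔ α = 0 ∧ μ = ν := by
  constructor
  · intro h
    have hs := congrArg Finsupp.degree h
    simp only [map_add, e1, Finsupp.degree_single, Nat.add_eq_right, Finsupp.degree_eq_zero_iff]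
      at hs
    subst hs
    exact ⟨rfl, e1_inj.1 (by simpa using h)⟩
  · rintro ⟨rfl, rfl⟩; simp

/-- The commutator of two derivations is determined by its values on generators. -/
theorem der_comm_eq {d d' d'' : Derivation ℂ (Wick M) (Wick M)}
    (h : ∀ G, d (d' (X G)) - d' (d (X G)) = d'' (X G)) (P : Wick M) :
    d (d' P) = d' (d P) + d'' P := by
  have : ⁅d, d'⁆ = d'' := by
    refine MvPolynomial.derivation_ext fun G => ?_
    rw [Derivation.commutator_apply]; exact h G
  rw [← this, Derivation.commutator_apply]; ring

/-- `D` raises the multi-index of every field it differentiates, so it never creates an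
undifferentiated field, and the commutator vanishes on generators. -/
theorem pderiv_D (i j : Fin 3) (φ : GluonField M.N) (μ : Fin 4) (P : Wick M) :
    pderiv (Gen.field j φ 0) (D i μ P) = D i μ (pderiv (Gen.field j φ 0) P) := by
  classical
  have h := der_comm_eq (d := pderiv (Gen.field j φ 0)) (d' := D i μ) (d'' := 0) (fun G => ?_) P
  · simpa using h
  · have hs : D i μ (pderiv (Gen.field j φ 0) (X G)) = 0 := by
      rw [pderiv_X, Pi.single_apply]; split_ifs <;> simp
    rw [hs]
    match G with
    | .bil p q => rw [D_bil]; split_ifs <;> simp [pderiv_X]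
    | .kern j k b m => simp only [D, mkDerivation_X]; split_ifs <;> simp [pderiv_X]
    | .field k ψ α =>
      simp only [D, mkDerivation_X]
      split_ifs <;> simp [pderiv_X, e1]

/-- Here the commutator is not zero: `D i μ` turns the undifferentiated `φ` into `∂_μ φ`, which the
partial derivative with respect to `∂_ν φ` detects exactly when `μ = ν`. -/
theorem pderiv_e1_D (i : Fin 3) (φ : GluonField M.N) (μ ν : Fin 4) (P : Wick M) :
    pderiv (Gen.field i φ (e1 ν)) (D i μ P) = D i μ (pderiv (Gen.field i φ (e1 ν)) P)
      + if μ = ν then pderiv (Gen.field i φ 0) P else 0 := by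
  classical
  have h := der_comm_eq (d := pderiv (Gen.field i φ (e1 ν))) (d' := D i μ)
    (d'' := if μ = ν then pderiv (Gen.field i φ 0) else 0) (fun G => ?_) P
  · rw [h]; split_ifs <;> simp
  · have hs : D i μ (pderiv (Gen.field i φ (e1 ν)) (X G)) = 0 := by
      rw [pderiv_X, Pi.single_apply]; split_ifs <;> simp
    rw [hs]
    match G with
    | .bil p q => rw [D_bil]; split_ifs <;> simp [pderiv_X]
    | .kern j k b m => simp only [D, mkDerivation_X]; split_ifs <;> simp [pderiv_X]
    | .field k ψ α =>
      simp only [D, mkDerivation_X]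
      by_cases hk : k = i
      · by_cases hμ : μ = ν
        · simp [hk, hμ, pderiv_X, Pi.single_apply]
        · simp [hk, hμ, pderiv_X, add_e1_eq_e1]
      · by_cases hμ : μ = ν <;> simp [hk, hμ, pderiv_X]

/-- The obstruction map is the sum of single contractions with two-point obstructions. -/
theorem obs_eq (o : ObsTable M) (ho : ∀ μ φ a, o μ φ (.w a) = 0) (i j : Fin 3)
    (Y : Fin 4 → Wick M) (V : Wick M)
    (hY : ∀ μ φ ν, pderiv (Gen.field i φ (e1 ν)) (Y μ) = 0) (hV : ∀ μ, D i μ V = 0) :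
    obs o i j Y V
      = ∑ μ, contr i (fun φ => contr j (fun χ => idlt i j (o μ φ χ)) V) (Y μ) := by
  have hV' : ∀ μ χ, D i μ (pderiv (Gen.field j χ 0) V) = 0 := fun μ χ => by
    rw [← pderiv_D, hV, map_zero]
  have h1 : ∀ φ ν, pderiv (Gen.field i φ (e1 ν)) (∑ μ, D i μ (Y μ))
      = pderiv (Gen.field i φ 0) (Y ν) := fun φ ν => by
    rw [map_sum]
    simp [pderiv_e1_D, hY]
  have h2 : ∀ φ, pderiv (Gen.field i φ 0) (∑ μ, D i μ (Y μ))
      = ∑ μ, D i μ (pderiv (Gen.field i φ 0) (Y μ)) := fun φ => by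
    rw [map_sum]
    exact Finset.sum_congr rfl fun μ _ => pderiv_D ..
  have hw : ∀ μ φ a, (idlt i j (o μ φ (.w a)) : Wick M) = 0 := fun μ φ a => by
    rw [ho, idlt_zero]
  have hR : ∀ μ, contr i (fun φ => contr j (fun χ => idlt i j (o μ φ χ)) V) (Y μ)
      = sumAFw fun φ => pderiv (Gen.field i φ 0) (Y μ)
        * sumAF fun χ => pderiv (Gen.field j χ 0) V * idlt i j (o μ φ χ) := fun μ => by
    rw [← sumAFw_pderiv]
    refine congrArg sumAFw (funext fun φ => ?_)
    rw [sumAF_pderiv j (fun χ => idlt i j (o μ φ χ)) (hw μ φ)]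
  obtain ⟨ι, _, u, hu⟩ := sumAFw_eq_sum (M := M)
  obtain ⟨κ, _, v, hv⟩ := sumAF_eq_sum (M := M)
  -- In `T[∂_μ Y^μ V']` the derivative falls either on the coefficient `∂Y^μ/∂φ` or on the
  -- contracted field. In the second case it produces `∂_μ` of the propagator plus the two-point
  -- obstruction. Subtracting `∂_μ T[Y^μ V']` cancels everything but the obstruction.
  simp only [hR, obs, Tprod, h1, h2, hY, zero_mul, Finset.sum_const_zero, add_zero, hu, hv]
  simp only [map_sum, Derivation.leibniz, hV', smul_eq_mul, mul_zero, zero_add, dprop]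
  rw [Finset.sum_comm (s := Finset.univ (α := Fin 4)), Finset.sum_comm (s := Finset.univ (α := Fin 4)),
    ← Finset.sum_sub_distrib]
  refine Finset.sum_congr rfl fun x _ => ?_
  rw [Finset.sum_comm (s := Finset.univ (α := Fin 4))]
  simp only [Finset.mul_sum]
  rw [Finset.sum_comm (s := Finset.univ (α := Fin 4)), ← Finset.sum_sub_distrib]
  refine Finset.sum_congr rfl fun y _ => ?_
  rw [Finset.sum_mul, ← Finset.sum_add_distrib, Finset.sum_mul, ← Finset.sum_sub_distrib]
  refine Finset.sum_congr rfl fun μ _ => ?_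
  ring

/-! ### First variations of the interactions -/

theorem g_mul_self (μ : Fin 4) : g μ * g μ = 1 := by
  unfold g; split_ifs <;> norm_num

theorem η_symm (μ ν : Fin 4) : η μ ν = η ν μ := by
  unfold η
  by_cases h : μ = ν
  · subst h; rfl
  · rw [if_neg h, if_neg (Ne.symm h)]

theorem sum_sum_eq_zero_of_antisymm {ι : Type*} [Fintype ι] (f : ι → ι → Wick M)
    (h : ∀ μ ν, f μ ν = -f ν μ) : ∑ μ, ∑ ν, f μ ν = 0 := by
  have hs : ∑ μ, ∑ ν, f μ ν = -∑ μ, ∑ ν, f μ ν := by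
    conv_lhs => rw [Finset.sum_comm]
    simp only [← Finset.sum_neg_distrib]
    exact Finset.sum_congr rfl fun μ _ => Finset.sum_congr rfl fun ν _ => h ν μ
  rw [eq_neg_iff_add_eq_zero, ← two_mul] at hs
  exact (mul_eq_zero.1 hs).resolve_left two_ne_zero

/-- The basis vector `ξ_a`. -/
def unit (a : Fin M.N) : LieW M := fun b => C (kd a b)

theorem ip_unit (a : Fin M.N) (X : LieW M) : ip (unit a) X = X a := by
  simp [ip, unit, kd, apply_ite C]

/-- The variation `∂L_1/∂A_κ`. -/
def Jsym (j : Fin 3) (κ : Fin 4) : LieW M :=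
  cur j κ + (C (1 / 2) : Wick M) •
    ∑ ν, (br (A j ν) (Fup j κ ν) + br (Fup j ν κ) (A j ν))

/-- Invariance of the inner product moves the inserted element `Z` out of the brackets. An arbitrary
derivation is allowed, so that the same formula serves Wick contractions (`Z` a basis vector) and
derivatives at another point (`Z = 0`). -/
theorem der_L1 (d : Derivation ℂ (Wick M) (Wick M)) (j : Fin 3) (Z : LieW M)
    (α : Fin 4 → Wick M) (β : Fin 4 → Fin 4 → Wick M)
    (hA : ∀ κ, mapLie d (A j κ) = α κ • Z) (hF : ∀ κ l, mapLie d (Fdn j κ l) = β κ l • Z)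
    (hc : ∀ κ, mapLie d (cur j κ) = 0) :
    d (L1 j) = ip Z (∑ κ, α κ • Jsym j κ
      + (C (1 / 2) : Wick M) • ∑ κ, ∑ l, (C (g κ * g l) * β κ l) • br (A j κ) (A j l)) := by
  have hF' : ∀ κ l, mapLie d (Fup j κ l) = (C (g κ * g l) * β κ l) • Z := fun κ l => by
    rw [Fup_eq, mapLie_C_smul, hF, smul_smul]
  simp only [L1, map_add, der_C_mul, map_sum, der_ip, mapLie_br, hA, hF', hc, ip_zero_right,
    add_zero, ip_add_right, ip_smul_left, br_smul_left, br_smul_right, ip_smul_right, ip_sum_right,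
    Jsym, Finset.sum_add_distrib, mul_add, smul_add]
  have h1 : ∀ μ ν, ip (Fup j μ ν) (br Z (A j ν)) = ip Z (br (A j ν) (Fup j μ ν)) := fun μ ν => by
    rw [ip_comm, ip_br_left]
  have h2 : ∀ μ ν, ip (Fup j μ ν) (br (A j μ) Z) = ip Z (br (Fup j μ ν) (A j μ)) := fun μ ν => by
    rw [← ip_br_left, ip_comm]
  simp only [h1, h2]
  rw [Finset.sum_comm (f := fun μ ν => α ν * ip Z (br (Fup j μ ν) (A j μ)))]
  have h3 : ∀ P : Wick M, ∀ κ, α κ * (C (1 / 2) * P) = C (1 / 2) * (α κ * P) :=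
    fun P κ => mul_left_comm _ _ _
  simp only [Finset.mul_sum, h3]
  ring

/-- The four entries of the quartic expression contribute equally after relabelling the contracted
indices; this turns the prefactor `-1/2` into `-2`. -/
theorem der_L2 (d : Derivation ℂ (Wick M) (Wick M)) (j : Fin 3) (Z : LieW M)
    (α : Fin 4 → Wick M) (hA : ∀ κ, mapLie d (A j κ) = α κ • Z) :
    d (L2 j) = C (-2 * (1 + (M.cF : ℂ))) *
      ip Z (∑ μ, ∑ ν, (C (g μ * g ν) * α μ) • br (A j ν) (br (A j μ) (A j ν))) := by
  have h1 : ∀ μ ν : Fin 4, ip (br Z (A j ν)) (br (A j μ) (A j ν))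
      = ip Z (br (A j ν) (br (A j μ) (A j ν))) := fun μ ν => ip_br_left ..
  have h2 : ∀ μ ν : Fin 4, ip (br (A j μ) Z) (br (A j μ) (A j ν))
      = ip Z (br (A j μ) (br (A j ν) (A j μ))) := fun μ ν => by
    rw [br_swap _ Z, br_swap (A j μ) (A j ν), ip_neg_left, ip_neg_right, neg_neg, ip_br_left]
  have h3 : ∀ μ ν : Fin 4, ip (br (A j μ) (A j ν)) (br Z (A j ν))
      = ip Z (br (A j ν) (br (A j μ) (A j ν))) := fun μ ν => by rw [ip_comm, h1]
  have h4 : ∀ μ ν : Fin 4, ip (br (A j μ) (A j ν)) (br (A j μ) Z)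
      = ip Z (br (A j μ) (br (A j ν) (A j μ))) := fun μ ν => by rw [ip_comm, h2]
  simp only [L2, der_C_mul, map_sum, der_ip, mapLie_br, Aup_eq, mapLie_C_smul, hA]
  simp only [br_smul_left, br_smul_right, ip_add_left, ip_add_right, ip_smul_left, ip_smul_right,
    ip_sum_right, h1, h2, h3, h4]
  set T : Fin 4 → Fin 4 → Wick M := fun μ ν =>
    C (g μ * g ν) * α μ * ip Z (br (A j ν) (br (A j μ) (A j ν))) with hT
  have hsum : ∑ μ, ∑ ν, ((T μ ν + T ν μ) + (T μ ν + T ν μ)) = 4 * ∑ μ, ∑ ν, T μ ν := by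
    simp only [Finset.sum_add_distrib]
    rw [Finset.sum_comm (f := fun μ ν => T ν μ)]
    ring
  have hc : (C (-2 * (1 + (M.cF : ℂ))) : Wick M) = C (-(1 / 2) * (1 + (M.cF : ℂ))) * 4 := by
    rw [show (4 : Wick M) = C 4 from (map_ofNat C 4).symm, ← C_mul]; congr 1; ring
  rw [hc, mul_assoc, ← hsum]
  refine congrArg _ (Finset.sum_congr rfl fun μ _ => Finset.sum_congr rfl fun ν _ => ?_)
  simp only [hT, C_mul]
  ring

/-- The product rule with `w` held fixed, as is appropriate for contractions because `O_μ(w, ·) =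
0`. With `W = 0` it also shows that partial derivatives with respect to `∂_ν φ` and derivatives at
other points vanish. -/
theorem der_Q2delta (d : Derivation ℂ (Wick M) (Wick M)) (i : Fin 3) (W : Fin 4 → LieW M)
    (hA : ∀ ν, mapLie d (A i ν) = W ν) (hw : mapLie d (w i) = 0) (μ : Fin 4) :
    d (Q2delta i μ) = C (-2 * (1 + (M.cF : ℂ))) * ∑ l, C (g μ * g l) *
      (ip (br (W μ) (A i l)) (br (w i) (A i l)) + ip (br (A i μ) (W l)) (br (w i) (A i l))
        + ip (br (A i μ) (A i l)) (br (w i) (W l))) := by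
  simp only [Q2delta, der_C_mul, map_sum, der_ip, mapLie_br, Aup_eq, mapLie_C_smul, hA, hw]
  simp only [br_smul_left, br_smul_right, ip_add_left, ip_smul_left, br_zero_left, zero_add,
    C_mul (a := g μ)]
  congr 1
  exact Finset.sum_congr rfl fun l _ => by ring

theorem der_Q1 (d : Derivation ℂ (Wick M) (Wick M)) (i : Fin 3) (W : Fin 4 → LieW M)
    (U : Fin 4 → Fin 4 → LieW M)
    (hA : ∀ ν, mapLie d (A i ν) = W ν) (hF : ∀ μ ν, mapLie d (Fdn i μ ν) = U μ ν)
    (hw : mapLie d (w i) = 0) (hc : ∀ κ, mapLie d (cur i κ) = 0) (μ : Fin 4) :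
    d (Q1 i μ) = ∑ ν, C (g μ * g ν) *
      (ip (U μ ν) (br (w i) (A i ν)) + ip (Fdn i μ ν) (br (w i) (W ν))) := by
  simp only [Q1, map_add, map_sum, der_ip, mapLie_br, Fup_eq, mapLie_C_smul, hA, hF, hw, hc]
  simp only [ip_smul_left, ip_zero_left, ip_zero_right, br_zero_left, zero_add, add_zero, mul_add]

/-! ### Components under derivations -/

theorem mapLie_contr_A (i : Fin 3) (h : GluonField M.N → Wick M) (μ : Fin 4) :
    mapLie (contr i h) (A i μ) = fun a => h (.A a μ) := by
  funext a; simp [mapLie, A, contr_fld]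

theorem mapLie_contr_Fdn (i : Fin 3) (h : GluonField M.N → Wick M) (μ ν : Fin 4) :
    mapLie (contr i h) (Fdn i μ ν) = fun a => h (.F a μ ν) := by
  funext a; simp [mapLie, Fdn, contr_fld]

theorem mapLie_contr_w (i : Fin 3) (h : GluonField M.N → Wick M) :
    mapLie (contr i h) (w i) = fun a => h (.w a) := by
  funext a; simp [mapLie, w, contr_fld]

theorem mapLie_cur_eq_zero (d : Derivation ℂ (Wick M) (Wick M)) (i : Fin 3)
    (h : ∀ p q : QuarkJet M.r, p.point = i → q.point = i → d (X (Gen.bil p q)) = 0) (μ : Fin 4) :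
    mapLie d (cur i μ) = 0 := by
  funext a
  simp only [mapLie, cur, map_sum, der_C_mul]
  refine Finset.sum_eq_zero fun s _ => Finset.sum_eq_zero fun s' _ => Finset.sum_eq_zero fun m _ =>
    Finset.sum_eq_zero fun n _ => ?_
  rw [h _ _ rfl rfl, mul_zero]

theorem mapLie_contr_cur (i j : Fin 3) (h : GluonField M.N → Wick M) (μ : Fin 4) :
    mapLie (contr i h) (cur j μ) = 0 :=
  mapLie_cur_eq_zero _ _ (fun _ _ _ _ => contr_bil ..) μ

theorem mapLie_D_of_ne {i j : Fin 3} (hij : i ≠ j) (φ : Fin M.N → GluonField M.N) (μ : Fin 4) :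
    mapLie (D i μ) (fun a => fld j (φ a) 0 : LieW M) = 0 := by
  funext a; simp [mapLie, D_fld, hij.symm]

theorem mapLie_D_cur_of_ne {i j : Fin 3} (hij : i ≠ j) (μ κ : Fin 4) :
    mapLie (D (M := M) i μ) (cur j κ) = 0 := by
  refine mapLie_cur_eq_zero _ _ (fun p q hp hq => ?_) κ
  rw [D_bil, hp, hq, if_neg hij.symm, if_neg hij.symm, add_zero]

theorem D_L1 {i j : Fin 3} (hij : i ≠ j) (μ : Fin 4) : D i μ (L1 j : Wick M) = 0 := by
  have h := der_L1 (D i μ) j (0 : LieW M) 0 0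
    (fun κ => (mapLie_D_of_ne hij (fun a => .A a κ) μ).trans (by simp))
    (fun κ l => (mapLie_D_of_ne hij (fun a => .F a κ l) μ).trans (by simp))
    (fun κ => mapLie_D_cur_of_ne hij μ κ)
  rw [h, ip_zero_left]

theorem D_L2 {i j : Fin 3} (hij : i ≠ j) (μ : Fin 4) : D i μ (L2 j : Wick M) = 0 := by
  have h := der_L2 (D i μ) j (0 : LieW M) 0
    (fun κ => (mapLie_D_of_ne hij (fun a => .A a κ) μ).trans (by simp))
  rw [h, ip_zero_left, mul_zero]

theorem mapLie_pderiv_e1 (i : Fin 3) (φ : GluonField M.N) (ν : Fin 4) (u : Fin M.N → GluonField M.N) :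
    mapLie (pderiv (Gen.field i φ (e1 ν))) (fun a => fld i (u a) 0 : LieW M) = 0 := by
  classical
  funext a
  simp [mapLie, fld, pderiv_X, e1]

theorem mapLie_pderiv_cur (i j : Fin 3) (φ : GluonField M.N) (α : Jet) (μ : Fin 4) :
    mapLie (pderiv (Gen.field i φ α)) (cur j μ : LieW M) = 0 := by
  classical
  refine mapLie_cur_eq_zero _ _ (fun p q _ _ => ?_) μ
  simp [pderiv_X]

theorem pderiv_e1_Q2delta (i : Fin 3) (φ : GluonField M.N) (μ ν : Fin 4) :
    pderiv (Gen.field i φ (e1 ν)) (Q2delta i μ) = 0 := by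
  rw [der_Q2delta _ i 0 (fun κ => mapLie_pderiv_e1 i φ ν fun a => .A a κ)
    (mapLie_pderiv_e1 i φ ν fun a => .w a)]
  simp [br_zero_left, br_zero_right, ip_zero_left, ip_zero_right]

theorem pderiv_e1_Q1 (i : Fin 3) (φ : GluonField M.N) (μ ν : Fin 4) :
    pderiv (Gen.field i φ (e1 ν)) (Q1 i μ) = 0 := by
  rw [der_Q1 _ i 0 0 (fun κ => mapLie_pderiv_e1 i φ ν fun a => .A a κ)
    (fun κ l => mapLie_pderiv_e1 i φ ν fun a => .F a κ l)
    (mapLie_pderiv_e1 i φ ν fun a => .w a) (fun κ => mapLie_pderiv_cur i i φ _ κ)]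
  simp [br_zero_right, ip_zero_left, ip_zero_right]

/-! ### The symmetrized obstruction -/

theorem oDelta_w (μ : Fin 4) (φ : GluonField M.N) (a : Fin M.N) : oDelta M μ φ (.w a) = 0 := by
  cases φ <;> simp [oDelta]

theorem oString_w (μ : Fin 4) (φ : GluonField M.N) (a : Fin M.N) : oString M μ φ (.w a) = 0 := by
  cases φ <;> simp [oString]

theorem oFull_w (μ : Fin 4) (φ : GluonField M.N) (a : Fin M.N) : oFull M μ φ (.w a) = 0 := by
  simp only [oFull, oDelta_w, oString_w, add_zero]

theorem D_Tprod_of_ne (o : ObsTable M) (i j k : Fin 3) (hk : k ≠ i) (hkj : k ≠ j) (μ : Fin 4)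
    (W V : Wick M) (hW : ∀ φ ν, pderiv (Gen.field i φ (e1 ν)) W = 0) (hW' : D k μ W = 0)
    (hV : D k μ V = 0) : D k μ (Tprod o i j W V) = 0 := by
  have h1 : ∀ φ, D k μ (pderiv (Gen.field i φ 0) W) = 0 := fun φ => by
    rw [← pderiv_D, hW', map_zero]
  have h2 : ∀ φ, D k μ (pderiv (Gen.field j φ 0) V) = 0 := fun φ => by
    rw [← pderiv_D, hV, map_zero]
  have h3 : ∀ φ χ, D k μ (prop i j φ χ : Wick M) = 0 := fun φ χ => by
    simp [prop, D_ker, D_idlt, hk.symm, hkj.symm]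
  obtain ⟨ι, _, u, hu⟩ := sumAFw_eq_sum (M := M)
  obtain ⟨κ, _, v, hv⟩ := sumAF_eq_sum (M := M)
  simp [Tprod, hu, hv, map_sum, Derivation.leibniz, h1, h2, h3, hW]

theorem D_dlt_add (μ : Fin 4) : D 0 μ (dlt 0 1 : Wick M) + D 1 μ (dlt 0 1) = 0 := by
  simp [dlt, D_ker]

theorem D_Q2delta_of_ne {i k : Fin 3} (h : k ≠ i) (μ ν : Fin 4) :
    D k ν (Q2delta i μ : Wick M) = 0 := by
  rw [der_Q2delta _ i 0 (fun κ => mapLie_D_of_ne h (fun a => .A a κ) ν)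
    (mapLie_D_of_ne h (fun a => .w a) ν)]
  simp [br_zero_left, br_zero_right, ip_zero_left, ip_zero_right]

/-- The undifferentiated delta function is taken out of the symmetrized obstruction. -/
theorem symObs_Q2delta (o : ObsTable M) :
    symObs o (Q2delta 0) (L1 2) = C (1 / 2) * (dlt 0 1 * obs o 0 2 (Q2delta 0) (L1 2)) := by
  have h : ∀ μ, D 1 μ (Tprod o 0 2 (Q2delta 0 μ) (L1 2)) = 0 := fun μ =>
    D_Tprod_of_ne o 0 2 1 (by decide) (by decide) μ _ _ (fun φ ν => pderiv_e1_Q2delta 0 φ μ ν)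
      (D_Q2delta_of_ne (by decide) μ μ) (D_L1 (by decide) μ)
  rw [symObs, obs, mul_sub (dlt 0 1), Finset.mul_sum (s := Finset.univ (α := Fin 4)) (a := dlt 0 1)]
  congr 2
  refine Finset.sum_congr rfl fun μ _ => ?_
  simp only [Derivation.leibniz, smul_eq_mul, h]
  -- The product does not depend on `x'`, and the gradients of `δ_{xx'}` at the two points cancel.
  linear_combination Tprod o 0 2 (Q2delta 0 μ) (L1 2) * D_dlt_add (M := M) μ

/-- The contraction of `Q_2|_δ` with a matrix of Lie algebra elements. -/
def contrQ2 (i : Fin 3) (W : Fin 4 → Fin 4 → LieW M) : Wick M :=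
  ∑ μ, ∑ l, C (g μ * g l) *
    (ip (br (W μ μ) (A i l)) (br (w i) (A i l)) + ip (br (A i μ) (W μ l)) (br (w i) (A i l))
      + ip (br (A i μ) (A i l)) (br (w i) (W μ l)))

/-- Contracting `A_ν` with `L_1''` under the derivative index `μ` replaces it by the Lie algebra
element `W μ ν`, a variation of `L1`: `α` weights the variation with respect to `A`, `β` the one
with respect to `F`. -/
theorem obs_Q2delta (o : ObsTable M) (ho : ∀ μ φ a, o μ φ (.w a) = 0)
    (ho' : ∀ μ χ a, o μ (.w a) χ = 0)
    (α : Fin 4 → Fin 4 → Fin 4 → KPoly) (β : Fin 4 → Fin 4 → Fin 4 → Fin 4 → KPoly)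
    (hα : ∀ μ a ν b κ, o μ (.A a ν) (.A b κ) = C (kd a b) * α μ ν κ)
    (hβ : ∀ μ a ν b κ l, o μ (.A a ν) (.F b κ l) = C (kd a b) * β μ ν κ l)
    (W : Fin 4 → Fin 4 → LieW M) (hW : ∀ μ ν, W μ ν =
      ∑ κ, (idlt 0 2 (α μ ν κ) : Wick M) • (Jsym 2 κ : LieW M)
      + (C (1 / 2) : Wick M) •
        ∑ κ, ∑ l, (C (g κ * g l) * idlt 0 2 (β μ ν κ l) : Wick M) • (br (A 2 κ) (A 2 l) : LieW M)) :
    obs o 0 2 (Q2delta 0) (L1 2) = C (-2 * (1 + (M.cF : ℂ))) * contrQ2 0 W := by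
  -- The factor `δ_{ab}` makes the insertion proportional to the basis vector `ξ_a`, and pairing
  -- with `ξ_a` extracts the component with index `a`.
  have hL1 : ∀ (h : GluonField M.N → Wick M) (a : Fin M.N) (α : Fin 4 → Wick M)
      (β : Fin 4 → Fin 4 → Wick M), (∀ b κ, h (.A b κ) = C (kd a b) * α κ) →
      (∀ b κ l, h (.F b κ l) = C (kd a b) * β κ l) →
      contr 2 h (L1 2) = (∑ κ, α κ • (Jsym 2 κ : LieW M) + (C (1 / 2) : Wick M) •
        ∑ κ, ∑ l, (C (g κ * g l) * β κ l) • br (A 2 κ) (A 2 l) : LieW M) a :=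
    fun h a α β hA hF => by
      rw [der_L1 _ 2 (unit a) α β (fun κ => ?_) (fun κ l => ?_) (fun κ => mapLie_contr_cur ..),
        ip_unit]
      · rw [mapLie_contr_A]; funext b; rw [hA, mul_comm]; rfl
      · rw [mapLie_contr_Fdn]; funext b; rw [hF, mul_comm]; rfl
  have hμ : ∀ μ, contr 0 (fun φ => contr 2 (fun χ => idlt 0 2 (o μ φ χ)) (L1 2)) (Q2delta 0 μ)
      = C (-2 * (1 + (M.cF : ℂ))) * ∑ l, C (g μ * g l) *
      (ip (br (W μ μ) (A 0 l)) (br (w 0) (A 0 l)) + ip (br (A 0 μ) (W μ l)) (br (w 0) (A 0 l))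
        + ip (br (A 0 μ) (A 0 l)) (br (w 0) (W μ l))) := fun μ => by
    refine der_Q2delta _ 0 (W μ) (fun ν => ?_) ?_ μ
    · rw [mapLie_contr_A, hW]
      funext a
      exact hL1 _ _ _ _ (fun b κ => by rw [hα, idlt_C_mul]) (fun b κ l => by rw [hβ, idlt_C_mul])
    · rw [mapLie_contr_w]
      funext a
      refine (hL1 _ a 0 0 (fun b κ => by simp [ho', idlt_zero])
        (fun b κ l => by simp [ho', idlt_zero])).trans ?_
      simp
  rw [obs_eq o ho 0 2 _ _ (fun μ φ ν => pderiv_e1_Q2delta 0 φ μ ν) (fun μ => D_L1 (by decide) μ),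
    contrQ2, Finset.mul_sum]
  exact Finset.sum_congr rfl fun μ _ => hμ μ

/-- The quartic expression `∂L_2/∂A_μ`, up to a factor. -/
def cubic (j : Fin 3) (μ : Fin 4) : LieW M :=
  ∑ ν, (C (g μ * g ν) : Wick M) • br (A j ν) (br (A j μ) (A j ν))

/-- In `L2` only `A` can be contracted, which always produces `cubic`. The two sums come from the
factors `F` and `A` of `Q1`; the current and `w` do not contribute. -/
theorem obs_Q1 (o : ObsTable M) (ho : ∀ μ φ a, o μ φ (.w a) = 0)
    (ho' : ∀ μ χ a, o μ (.w a) χ = 0)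
    (α : Fin 4 → Fin 4 → Fin 4 → KPoly) (β : Fin 4 → Fin 4 → KPoly)
    (hα : ∀ μ a ν b κ, o μ (.A a ν) (.A b κ) = C (kd a b) * α μ ν κ)
    (hβ : ∀ μ a ρ ν b κ, o μ (.F a ρ ν) (.A b κ)
      = C (kd a b) * fromDiv (fun n => β n κ) μ ρ ν) :
    obs o 0 1 (Q1 0) (L2 1) = C (-2 * (1 + (M.cF : ℂ))) *
      (∑ ν, ip (∑ κ, (C (g ν) * idlt 0 1 (β ν κ) : Wick M) • (cubic 1 κ : LieW M)) (br (w 0) (A 0 ν))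
        + ∑ μ, ∑ ν, C (g μ * g ν) *
            ip (Fdn 0 μ ν) (br (w 0) (∑ κ, (idlt 0 1 (α μ ν κ) : Wick M) • (cubic 1 κ : LieW M)))) := by
  set c : Wick M := C (-2 * (1 + (M.cF : ℂ)))
  have hL2 : ∀ (h : GluonField M.N → Wick M) (a : Fin M.N) (α : Fin 4 → Wick M),
      (∀ b κ, h (.A b κ) = C (kd a b) * α κ) →
      contr 1 h (L2 1) = (c • ∑ κ, α κ • (cubic 1 κ : LieW M)) a := fun h a α hh => by
    rw [der_L2 _ 1 (unit a) α fun κ => ?_, ip_unit]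
    · refine congrArg (c * ·) (congrFun ?_ a)
      simp only [cubic, Finset.smul_sum, smul_smul]
      exact Finset.sum_congr rfl fun κ _ => Finset.sum_congr rfl fun ν _ => by rw [mul_comm]
    · rw [mapLie_contr_A]; funext b; rw [hh, mul_comm]; rfl
  -- The trace of `fromDiv` returns the prescribed divergence: `1/3 (4 - 1) = 1` in four dimensions.
  have hsum : ∀ ν κ, ∑ μ, C (g μ) * idlt 0 1 (fromDiv (fun n => β n κ) μ μ ν)
      = (idlt 0 1 (β ν κ) : Wick M) := fun ν κ => by
    simp only [← idlt_C_mul, ← idlt_sum]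
    congr 1
    simp only [fromDiv, η, if_true, mul_sub, Finset.sum_sub_distrib]
    have h1 : ∀ μ : Fin 4, (C (g μ) * (C (1 / 3) * (C (g μ) * β ν κ)) : KPoly)
        = C (1 / 3) * β ν κ := fun μ => by
      linear_combination (C (1 / 3) * β ν κ) * (by rw [← C_mul, g_mul_self, C_1] :
        (C (g μ) * C (g μ) : KPoly) = 1)
    have h2 : ∀ μ : Fin 4, (C (g μ) * (C (1 / 3) * (C (if μ = ν then g μ else 0) * β μ κ)) : KPoly)
        = if μ = ν then C (1 / 3) * β μ κ else 0 := fun μ => by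
      split_ifs
      · linear_combination (C (1 / 3) * β μ κ) * (by rw [← C_mul, g_mul_self, C_1] :
          (C (g μ) * C (g μ) : KPoly) = 1)
      · simp
    simp only [h1, h2, Finset.sum_ite_eq', Finset.mem_univ, if_true, Finset.sum_const,
      Finset.card_univ, Fintype.card_fin]
    have h3 : (3 : KPoly) * C (1 / 3) = 1 := by
      rw [show (3 : KPoly) = C 3 from (map_ofNat C 3).symm, ← C_mul]; norm_num
    rw [nsmul_eq_mul]
    push_cast
    linear_combination (β ν κ) * h3
  rw [obs_eq o ho 0 1 _ _ (fun μ φ ν => pderiv_e1_Q1 0 φ μ ν) (fun μ => D_L2 (by decide) μ)]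
  have hμ : ∀ μ, contr 0 (fun φ => contr 1 (fun χ => idlt 0 1 (o μ φ χ)) (L2 1)) (Q1 0 μ)
      = ∑ ν, C (g μ * g ν) *
        (ip (c • ∑ κ, (idlt 0 1 (fromDiv (fun n => β n κ) μ μ ν) : Wick M) • (cubic 1 κ : LieW M)) (br (w 0) (A 0 ν))
        + ip (Fdn 0 μ ν) (br (w 0) (c • ∑ κ, (idlt 0 1 (α μ ν κ) : Wick M) • (cubic 1 κ : LieW M)))) := fun μ => by
    refine der_Q1 _ 0 _
      (fun ρ ν => c • ∑ κ, (idlt 0 1 (fromDiv (fun n => β n κ) μ ρ ν) : Wick M) • (cubic 1 κ : LieW M))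
      (fun ν => ?_) (fun ρ ν => ?_) ?_ (fun κ => mapLie_contr_cur ..) μ
    · rw [mapLie_contr_A]
      funext a
      exact hL2 _ _ _ fun b κ => by rw [hα, idlt_C_mul]
    · rw [mapLie_contr_Fdn]
      funext a
      exact hL2 _ _ _ fun b κ => by rw [hβ, idlt_C_mul]
    · rw [mapLie_contr_w]
      funext a
      refine (hL2 _ a 0 fun b κ => by simp [ho', idlt_zero]).trans ?_
      simp
  simp only [hμ, mul_add, Finset.sum_add_distrib, br_smul_right, ip_smul_right, ip_smul_left]
  congr 1
  · rw [Finset.sum_comm, Finset.mul_sum]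
    refine Finset.sum_congr rfl fun ν _ => ?_
    simp only [← hsum, ip_sum_left, ip_smul_left, Finset.mul_sum, Finset.sum_mul]
    rw [Finset.sum_comm]
    refine Finset.sum_congr rfl fun κ _ => Finset.sum_congr rfl fun μ _ => ?_
    rw [C_mul]; ring
  · simp only [Finset.mul_sum]
    exact Finset.sum_congr rfl fun μ _ => Finset.sum_congr rfl fun ν _ => by ring

/-! ### Consequences of the field equations -/

/-- Antisymmetry of `F` is not built into the generators; it follows from the two curl relations
with interchanged indices. -/
theorem Fdn_antisymm_mem_onShell (i : Fin 3) (μ ν : Fin 4) (a : Fin M.N) :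
    (Fdn i μ ν + Fdn i ν μ : LieW M) a ∈ onShell M := by
  have h := add_mem (Rel.curl i a μ ν 0).mem_onShell (Rel.curl i a ν μ 0).mem_onShell
  convert h using 1
  simp only [Pi.add_apply, Fdn]; ring

theorem D_mem_onShell (i : Fin 3) (μ : Fin 4) {P : Wick M} (hP : P ∈ onShell M) :
    D i μ P ∈ onShell M := D_mem_diffIdeal i μ hP

/-- The colour matrices factor out, and for each pair of colours the derivative of `ψ̄` and the
derivative of `ψ` give combinations of the two Dirac equations. -/
theorem sum_D_cur_mem_onShell (j : Fin 3) (a : Fin M.N) :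
    ∑ κ, D j κ (cur j κ a) ∈ onShell M := by
  have h : ∑ κ, D j κ (cur j κ a : Wick M)
      = ∑ m, ∑ n, C (M.t a m n) *
        (∑ s', ∑ κ, ∑ s, C (M.γ κ s s') *
            X (Gen.bil ⟨j, s, m, 0 + e1 κ⟩ ⟨j, s', n, 0⟩)
          + ∑ s, ∑ κ, ∑ s', C (M.γ κ s s') *
            X (Gen.bil ⟨j, s, m, 0⟩ ⟨j, s', n, 0 + e1 κ⟩)) := by
    have h1 : ∀ κ, D j κ (cur j κ a : Wick M) = ∑ m, ∑ n, C (M.t a m n) *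
        (∑ s', ∑ s, C (M.γ κ s s') * X (Gen.bil ⟨j, s, m, 0 + e1 κ⟩ ⟨j, s', n, 0⟩)
          + ∑ s, ∑ s', C (M.γ κ s s') * X (Gen.bil ⟨j, s, m, 0⟩ ⟨j, s', n, 0 + e1 κ⟩)) := fun κ => by
      simp only [cur, map_sum, der_C_mul, D_bil, if_true]
      rw [Finset.sum_congr rfl fun s _ => Finset.sum_comm, Finset.sum_comm]
      refine Finset.sum_congr rfl fun m _ => ?_
      rw [Finset.sum_congr rfl fun s _ => Finset.sum_comm, Finset.sum_comm]
      refine Finset.sum_congr rfl fun n _ => ?_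
      rw [Finset.sum_comm (s := Finset.univ (α := Fin 4)) (f := fun s' s =>
        C (M.γ κ s s') * X (Gen.bil ⟨j, s, m, 0 + e1 κ⟩ ⟨j, s', n, 0⟩)),
        ← Finset.sum_add_distrib, Finset.mul_sum]
      refine Finset.sum_congr rfl fun s _ => ?_
      rw [← Finset.sum_add_distrib, Finset.mul_sum]
      refine Finset.sum_congr rfl fun s' _ => ?_
      rw [C_mul]; ring
    simp only [h1]
    rw [Finset.sum_comm]
    refine Finset.sum_congr rfl fun m _ => ?_
    rw [Finset.sum_comm]
    refine Finset.sum_congr rfl fun n _ => ?_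
    rw [← Finset.mul_sum, Finset.sum_add_distrib]
    refine congrArg _ (congrArg₂ _ ?_ ?_) <;> exact Finset.sum_comm
  rw [h]
  refine sum_mem fun m _ => sum_mem fun n _ => Ideal.mul_mem_left _ _ (add_mem ?_ ?_)
  · exact sum_mem fun s' _ => (Rel.dirac' ⟨j, s', n, 0⟩ j s' m 0).mem_onShell
  · exact sum_mem fun s _ => (Rel.dirac ⟨j, s, m, 0⟩ j s n 0).mem_onShell

theorem sum_D_F_mem_onShell (j : Fin 3) (ν : Fin 4) (a : Fin M.N) :
    (∑ κ, mapLie (D j κ) (Fup j κ ν) : LieW M) a ∈ onShell M := by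
  have h : (∑ κ, mapLie (D j κ) (Fup j κ ν) : LieW M) a
      = C (g ν) * ∑ κ, C (g κ) * fld j (.F a κ ν) (0 + e1 κ) := by
    rw [Finset.sum_apply, Finset.mul_sum]
    refine Finset.sum_congr rfl fun κ _ => ?_
    rw [Fup_eq, mapLie_C_smul]
    simp only [Pi.smul_apply, smul_eq_mul, mapLie, Fdn, D_fld, if_true, C_mul]
    ring
  rw [h]
  exact Ideal.mul_mem_left _ _ (Rel.divF j a ν 0).mem_onShell

theorem sum_D_F_mem_onShell' (j : Fin 3) (ν : Fin 4) (a : Fin M.N) :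
    (∑ κ, mapLie (D j κ) (Fup j ν κ) : LieW M) a ∈ onShell M := by
  have h : (∑ κ, mapLie (D j κ) (Fup j ν κ) : LieW M) a
      = ∑ κ, C (g κ * g ν) * D j κ ((Fdn j κ ν + Fdn j ν κ : LieW M) a)
        - (∑ κ, mapLie (D j κ) (Fup j κ ν) : LieW M) a := by
    rw [eq_sub_iff_add_eq, Finset.sum_apply, Finset.sum_apply, ← Finset.sum_add_distrib]
    refine Finset.sum_congr rfl fun κ _ => ?_
    simp only [Fup_eq, mapLie_C_smul, Pi.add_apply, map_add]
    simp only [Pi.smul_apply, smul_eq_mul, mapLie, mul_comm (g ν)]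
    ring
  rw [h]
  exact sub_mem (sum_mem fun κ _ => Ideal.mul_mem_left _ _
    (D_mem_onShell j κ (Fdn_antisymm_mem_onShell j κ ν a))) (sum_D_F_mem_onShell j ν a)

theorem curl_mem_onShell (j : Fin 3) (κ ν : Fin 4) (a : Fin M.N) :
    (mapLie (D j κ) (A j ν) - mapLie (D j ν) (A j κ) - Fdn j κ ν : LieW M) a ∈ onShell M := by
  have h := neg_mem (Rel.curl j a κ ν 0).mem_onShell
  convert h using 1
  simp only [Pi.sub_apply, mapLie, A, Fdn, D_fld, if_true]; ring

/-- The current `∂L_1/∂A_κ` is conserved. -/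
theorem sum_D_Jsym_mem_onShell (j : Fin 3) (a : Fin M.N) :
    (∑ κ, mapLie (D j κ) (Jsym j κ) : LieW M) a ∈ onShell M := by
  set dA : Fin 4 → Fin 4 → LieW M := fun κ ν => mapLie (D j κ) (A j ν)
  -- By the Leibniz rule there remain divergences of `F` and terms with derivatives of `A`. After
  -- relabelling, the latter are `F^{κν}` bracketed with the curl of `A`; subtracting `F_{κν}` from
  -- the curl costs nothing, because `[F, F] = 0`, and makes it vanish on shell.
  have h : (∑ κ, mapLie (D j κ) (Jsym j κ) : LieW M)
      = ∑ κ, mapLie (D j κ) (cur j κ) + (C (1 / 2) : Wick M) •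
        (∑ ν, br (A j ν) (∑ κ, mapLie (D j κ) (Fup j κ ν))
          + ∑ ν, br (∑ κ, mapLie (D j κ) (Fup j ν κ)) (A j ν)
          - ∑ κ, ∑ ν, br (Fup j κ ν) (dA κ ν - dA ν κ - Fdn j κ ν)) := by
    have hF : ∀ κ ν, br (Fup j κ ν) (Fdn j κ ν : LieW M) = 0 := fun κ ν => by
      rw [Fup_eq, br_smul_left, br_self, smul_zero]
    have hsub : ∀ X Y Z : LieW M, br X (Y - Z) = br X Y - br X Z := fun X Y Z => by
      rw [sub_eq_add_neg, br_add_right, br_neg_right, ← sub_eq_add_neg]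
    simp only [Jsym, mapLie_add, mapLie_C_smul, mapLie_sum, mapLie_br, Finset.sum_add_distrib,
      ← Finset.smul_sum, hsub, hF, sub_zero, br_sum_left, br_sum_right, Finset.sum_sub_distrib]
    refine congrArg (fun Z : LieW M => _ + (C (1 / 2) : Wick M) • Z) ?_
    rw [Finset.sum_comm (f := fun ν κ => br (A j ν) (mapLie (D j κ) (Fup j κ ν))),
      Finset.sum_comm (f := fun ν κ => br (mapLie (D j κ) (Fup j ν κ)) (A j ν)),
      Finset.sum_comm (f := fun κ ν => br (Fup j κ ν) (dA ν κ))]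
    have h1 : ∀ κ ν, br (mapLie (D j κ) (A j ν)) (Fup j κ ν) = -br (Fup j κ ν) (dA κ ν) :=
      fun κ ν => br_swap _ _
    simp only [h1, Finset.sum_neg_distrib]
    abel
  rw [h]
  simp only [Pi.add_apply, Pi.smul_apply, Pi.sub_apply, Finset.sum_apply, smul_eq_mul]
  refine add_mem (sum_D_cur_mem_onShell j a) (Ideal.mul_mem_left _ _ (sub_mem (add_mem ?_ ?_) ?_))
  · exact sum_mem fun ν _ => br_mem_right _ (sum_D_F_mem_onShell j ν) a
  · exact sum_mem fun ν _ => br_mem_left (sum_D_F_mem_onShell' j ν) _ a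
  · exact sum_mem fun κ _ => sum_mem fun ν _ => br_mem_right _ (curl_mem_onShell j κ ν) a

/-! ### Localization -/

theorem A_loc {i j : Fin 3} (h : i ≠ j) (μ : Fin 4) (a : Fin M.N) :
    dlt i j * (A j μ a - A i μ a) ∈ onShell M := by
  have := neg_mem (Rel.loc i j h (.A a μ) 0).mem_onShell
  convert this using 1
  simp only [A]; ring

/-- Telescoping: one factor of the bracket is changed at a time. Iteration transports nested
brackets from one argument of a delta function to the other. -/
theorem br_loc {J : Ideal (Wick M)} {r : Wick M} {X X' Y Y' : LieW M}
    (hX : ∀ a, r * (X a - X' a) ∈ J) (hY : ∀ a, r * (Y a - Y' a) ∈ J) (c : Fin M.N) :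
    r * (br X Y c - br X' Y' c) ∈ J := by
  have h : r • (br X Y - br X' Y') = br (r • (X - X')) Y + br X' (r • (Y - Y')) := by
    rw [br_smul_left, br_smul_right, ← smul_add, sub_eq_add_neg X, sub_eq_add_neg Y, br_add_left,
      br_add_right, br_neg_left, br_neg_right]
    congr 1; abel
  have hc := congrFun h c
  simp only [Pi.smul_apply, Pi.sub_apply, smul_eq_mul, Pi.add_apply] at hc
  rw [hc]
  exact add_mem (br_mem_left hX _ c) (br_mem_right _ hY c)

theorem cubic_loc {i j : Fin 3} (h : i ≠ j) (μ : Fin 4) (a : Fin M.N) :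
    dlt i j * (cubic j μ a - cubic i μ a) ∈ onShell M := by
  simp only [cubic, Finset.sum_apply, Pi.smul_apply, smul_eq_mul, ← Finset.sum_sub_distrib,
    Finset.mul_sum]
  refine sum_mem fun ν _ => ?_
  rw [← mul_sub, mul_left_comm]
  exact Ideal.mul_mem_left _ _ (br_loc (A_loc h ν) (br_loc (A_loc h μ) (A_loc h ν)) a)

/-- The quartic term `⟨w | i[A^ν, i[A^λ, i[A_ν, A_λ]]]⟩` vanishes by the Jacobi identity. -/
theorem sum_ip_cubic (i : Fin 3) :
    (∑ ν, ip (cubic i ν) (br (w i) (A i ν)) : Wick M) = 0 := by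
  have h : ∀ ν, ip (cubic i ν) (br (w i) (A i ν)) = ∑ l, (C (g ν * g l) : Wick M) *
      ip (w i) (br (A i ν) (br (A i l) (br (A i ν) (A i l)))) := fun ν => by
    simp only [cubic, ip_sum_left, ip_smul_left]
    refine Finset.sum_congr rfl fun l _ => ?_
    rw [ip_comm, ip_br_left]
  simp only [h]
  refine sum_sum_eq_zero_of_antisymm _ fun ν l => ?_
  -- The third entry is `[A_ν, A_l]` itself, so one of the three terms vanishes, and the other two
  -- say that the outer brackets commute. Exchanging `ν` and `l` then only flips the sign of the
  -- innermost bracket.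
  have hJ := br_jacobi (A i ν) (A i l) (br (A i ν) (A i l) : LieW M)
  rw [br_self, add_zero, br_swap _ (A i ν), br_neg_right, add_neg_eq_zero] at hJ
  rw [hJ, br_swap (A i l) (A i ν), br_neg_right, br_neg_right, ip_neg_right, mul_comm (g l)]
  ring

/-! ### The contraction with a matrix of Lie algebra elements -/

theorem contrQ2_add (i : Fin 3) (W V : Fin 4 → Fin 4 → LieW M) :
    contrQ2 i (fun μ ν => W μ ν + V μ ν) = contrQ2 i W + contrQ2 i V := by
  simp only [contrQ2, br_add_left, br_add_right, ip_add_left, ip_add_right,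
    ← Finset.sum_add_distrib]
  exact Finset.sum_congr rfl fun μ _ => Finset.sum_congr rfl fun l _ => by ring

theorem contrQ2_smul (i : Fin 3) (r : Wick M) (W : Fin 4 → Fin 4 → LieW M) :
    contrQ2 i (fun μ ν => r • W μ ν) = r * contrQ2 i W := by
  simp only [contrQ2, br_smul_left, br_smul_right, ip_smul_left, ip_smul_right, Finset.mul_sum]
  exact Finset.sum_congr rfl fun μ _ => Finset.sum_congr rfl fun l _ => by ring

theorem contrQ2_mem {J : Ideal (Wick M)} (i : Fin 3) {W : Fin 4 → Fin 4 → LieW M}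
    (h : ∀ μ ν a, W μ ν a ∈ J) : contrQ2 i W ∈ J :=
  sum_mem fun μ _ => sum_mem fun l _ => J.mul_mem_left _ <| add_mem (add_mem
    (ip_mem_left (br_mem_left (h μ μ) _) _) (ip_mem_left (br_mem_right _ (h μ l)) _))
    (ip_mem_right _ (br_mem_right _ (h μ l)))

/-- The first term contains `[A_μ, A_μ] = 0`, the third one vanishes by invariance because `[A_μ,
A_l]` occurs twice, and the second one is the quartic expression killed by the Jacobi identity. -/
theorem contrQ2_br (i : Fin 3) : contrQ2 i (fun μ ν => br (A i μ) (A i ν)) = (0 : Wick M) := by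
  have h : ∀ μ l, ip (br (A i μ) (A i l)) (br (w i) (br (A i μ) (A i l))) = (0 : Wick M) :=
    fun μ l => by rw [ip_comm, ip_br_left, br_self, ip_zero_right]
  have h' : ∀ μ l, ip (br (A i μ) (br (A i μ) (A i l))) (br (w i) (A i l))
      = -(ip (br (A i μ) (br (A i l) (A i μ))) (br (w i) (A i l)) : Wick M) := fun μ l => by
    rw [br_swap (A i μ) (A i l), br_neg_right, ip_neg_left]
  simp only [contrQ2, br_self, br_zero_left, ip_zero_left, zero_add, h, add_zero, h', mul_neg,
    Finset.sum_neg_distrib]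
  rw [neg_eq_zero, Finset.sum_comm, ← sum_ip_cubic i]
  refine Finset.sum_congr rfl fun l _ => ?_
  simp only [cubic, ip_sum_left, ip_smul_left, mul_comm (g l)]

/-- The contraction `∑ g_l ⟨i[V, A_l] | i[w, A_l]⟩`. -/
def contrDiag (i : Fin 3) (V : LieW M) : Wick M :=
  ∑ l, C (g l) * ip (br V (A i l)) (br (w i) (A i l))

theorem contrDiag_add (i : Fin 3) (V V' : LieW M) :
    contrDiag i (V + V') = contrDiag i V + contrDiag i V' := by
  simp only [contrDiag, br_add_left, ip_add_left, mul_add, Finset.sum_add_distrib]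

theorem contrDiag_smul (i : Fin 3) (r : Wick M) (V : LieW M) :
    contrDiag i (r • V) = r * contrDiag i V := by
  simp only [contrDiag, br_smul_left, ip_smul_left, Finset.mul_sum, mul_left_comm]

theorem contrDiag_sum {ι : Type*} (s : Finset ι) (i : Fin 3) (V : ι → LieW M) :
    contrDiag i (∑ n ∈ s, V n) = ∑ n ∈ s, contrDiag i (V n) :=
  map_sum (AddMonoidHom.mk' (contrDiag i) (contrDiag_add i)) V s

theorem contrDiag_mem {J : Ideal (Wick M)} (i : Fin 3) {V : LieW M} (h : ∀ a, V a ∈ J) :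
    contrDiag i V ∈ J :=
  sum_mem fun _ _ => J.mul_mem_left _ (ip_mem_left (br_mem_left h _) _)

theorem C_g_mul_g_mul_η (μ ν : Fin 4) :
    (C (g μ * g ν) * C (η μ ν) : Wick M) = if μ = ν then C (g μ) else 0 := by
  rw [← C_mul]
  unfold η
  split_ifs with h
  · rw [← h, g_mul_self, one_mul]
  · simp

/-- The factor is `4 - 1`: the trace of the metric from the first entry, and minus one from the
second entry with the bracket reversed. The third entry contains `[A_μ, A_μ] = 0`. -/
theorem contrQ2_diag (i : Fin 3) (V : LieW M) :
    contrQ2 i (fun μ ν => (C (η μ ν) : Wick M) • V) = 3 * contrDiag i V := by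
  have h1 : ∀ μ l, (C (g μ * g l) : Wick M) *
        (C (η μ μ) * ip (br V (A i l)) (br (w i) (A i l))
          + C (η μ l) * ip (br (A i μ) V) (br (w i) (A i l))
          + C (η μ l) * ip (br (A i μ) (A i l)) (br (w i) V))
      = C (g l) * ip (br V (A i l)) (br (w i) (A i l))
        - (if μ = l then C (g l) * ip (br V (A i l)) (br (w i) (A i l)) else 0) := fun μ l => by
    have hμ : (C (g μ * g l) * C (η μ μ) : Wick M) = C (g l) := by
      rw [← C_mul, η, if_pos rfl, mul_right_comm, g_mul_self, one_mul]
    rw [mul_add, mul_add, ← mul_assoc, ← mul_assoc, ← mul_assoc, hμ, C_g_mul_g_mul_η]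
    split_ifs with h
    · subst h
      rw [br_self, ip_zero_left, br_swap (A i μ) V, ip_neg_left]; ring
    · ring
  simp only [contrQ2, br_smul_left, br_smul_right, ip_smul_left, ip_smul_right, h1,
    Finset.sum_sub_distrib, contrDiag]
  rw [Finset.sum_comm (f := fun μ l => if μ = l then
    C (g l) * ip (br V (A i l)) (br (w i) (A i l)) else 0)]
  simp only [Finset.sum_ite_eq', Finset.mem_univ, if_true, Finset.sum_const, Finset.card_univ,
    Fintype.card_fin, nsmul_eq_mul]
  push_cast; ring

/-- In the last term the symmetric matrix meets the antisymmetric `[A_μ, A_l]`, so only the trace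
and the off-diagonal contraction with `A^μ` remain. -/
theorem contrQ2_symm (i : Fin 3) (S : Fin 4 → Fin 4 → LieW M) (hS : ∀ μ ν, S μ ν = S ν μ) :
    contrQ2 i S = contrDiag i (∑ μ, (C (g μ) : Wick M) • S μ μ)
      + ∑ μ, ∑ l, C (g μ * g l) * ip (br (A i μ) (S μ l)) (br (w i) (A i l)) := by
  have h3 : ∑ μ, ∑ l, C (g μ * g l) * ip (br (A i μ) (A i l)) (br (w i) (S μ l)) = 0 :=
    sum_sum_eq_zero_of_antisymm _ fun μ l => by
      rw [br_swap, ip_neg_left, hS, mul_comm (g μ)]; ring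
  simp only [contrQ2, mul_add, Finset.sum_add_distrib, h3, add_zero, contrDiag, br_sum_left,
    br_smul_left, ip_sum_left, ip_smul_left, Finset.mul_sum]
  rw [Finset.sum_comm (f := fun μ l => C (g μ * g l) * ip (br (S μ μ) (A i l)) (br (w i) (A i l)))]
  refine congrArg (· + _) (Finset.sum_congr rfl fun l _ => Finset.sum_congr rfl fun μ _ => ?_)
  rw [C_mul]; ring

/-! ### The obstructions without string integrations -/

theorem obs_Q1_oDelta_mem : obs (oDelta M) 0 1 (Q1 0) (L2 1) ∈ onShell M := by
  rw [obs_Q1 (oDelta M) oDelta_w (fun μ χ a => by cases χ <;> simp [oDelta]) 0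
    (fun ν κ => -C (η ν κ)) (fun μ a ν b κ => by simp [oDelta])
    (fun μ a ρ ν b κ => by simp [oDelta, GluonField.idx])]
  have h1 : ∀ ν, (∑ κ, (C (g ν) * idlt 0 1 (-C (η ν κ)) : Wick M) • (cubic 1 κ : LieW M))
      = (-C Complex.I : Wick M) • (dlt 0 1 : Wick M) • (cubic 1 ν : LieW M) := fun ν => by
    rw [Finset.sum_eq_single ν]
    · rw [idlt_neg, idlt_C, smul_smul]
      congr 1
      rw [η, if_pos rfl, C_mul]
      linear_combination (-C Complex.I * dlt 0 1) * (by rw [← C_mul, g_mul_self, C_1] :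
        (C (g ν) * C (g ν) : Wick M) = 1)
    · intro κ _ hκ
      rw [η, if_neg (Ne.symm hκ), C_0, neg_zero, idlt_zero, mul_zero, zero_smul]
    · simp
  -- The expression with all fields at `x` vanishes identically, so it may be subtracted; the
  -- difference is then zero by localization at the delta function.
  have h2 : ∑ ν, ip ((dlt 0 1 : Wick M) • (cubic 1 ν : LieW M)) (br (w 0) (A 0 ν))
      = ∑ ν, ip ((dlt 0 1 : Wick M) • (cubic 1 ν - cubic 0 ν : LieW M)) (br (w 0) (A 0 ν)) := by
    have h := congrArg (dlt 0 1 * ·) (sum_ip_cubic (M := M) 0)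
    simp only [mul_zero, Finset.mul_sum, ← ip_smul_left] at h
    rw [← sub_eq_zero, ← Finset.sum_sub_distrib, ← h]
    refine Finset.sum_congr rfl fun ν _ => ?_
    simp only [ip_smul_left, sub_eq_add_neg, ip_add_left, ip_neg_left]
    ring
  simp only [h1, ip_smul_left (-C Complex.I), ← Finset.mul_sum, h2, Pi.zero_apply, idlt_zero,
    zero_smul, Finset.sum_const_zero, br_zero_right, ip_zero_right, mul_zero, add_zero]
  exact Ideal.mul_mem_left _ _ (Ideal.mul_mem_left _ _
    (sum_mem fun ν _ => ip_mem_left (cubic_loc (by decide) ν) _))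

/-- Only the `A`–`F` obstruction contributes. It inserts a multiple of `[A_μ, A_ν]` for `A_ν`, the
matrix to which `contrQ2_br` applies. -/
theorem obs_Q2delta_oDelta_mem : obs (oDelta M) 0 2 (Q2delta 0) (L1 2) ∈ onShell M := by
  -- The two terms of the antisymmetrized metric tensor give the same bracket twice, which cancels
  -- the factor `1/2` from `L1`.
  have hW : ∀ μ ν, (C (-(1 / 2) * M.cF * Complex.I) * dlt 0 2 : Wick M) • (br (A 2 μ) (A 2 ν) : LieW M)
      = ∑ κ, (idlt 0 2 (0 : KPoly) : Wick M) • (Jsym 2 κ : LieW M)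
      + (C (1 / 2) : Wick M) • ∑ κ, ∑ l, (C (g κ * g l) *
        idlt 0 2 (C (-(1 / 2) * (M.cF : ℂ) * (η μ κ * η ν l - η μ l * η ν κ))) : Wick M)
          • br (A 2 κ) (A 2 l) := fun μ ν => by
    have hc : ∀ κ l, (C (g κ * g l) *
        idlt 0 2 (C (-(1 / 2) * (M.cF : ℂ) * (η μ κ * η ν l - η μ l * η ν κ))) : Wick M)
        = C (-(1 / 2) * M.cF * Complex.I) * dlt 0 2 *
          ((if μ = κ then if ν = l then 1 else 0 else 0)
            - (if μ = l then if ν = κ then 1 else 0 else 0)) := fun κ l => by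
      have hg : g κ * g l * (η μ κ * η ν l - η μ l * η ν κ)
          = (if μ = κ then if ν = l then 1 else 0 else 0)
            - (if μ = l then if ν = κ then 1 else 0 else 0) := by
        have h1 : ∀ a b, g b * η a b = if a = b then 1 else 0 := fun a b => by
          unfold η
          split_ifs with h
          · rw [h, g_mul_self]
          · simp
        have h2 : ∀ a b c d, g b * g d * (η a b * η c d)
            = if a = b then if c = d then 1 else 0 else 0 := fun a b c d => by
          calc _ = (g b * η a b) * (g d * η c d) := by ring
            _ = _ := by rw [h1, h1]; split_ifs <;> simp
        rw [mul_sub, h2, mul_comm (g κ), h2]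
      have hC : (C ((if μ = κ then if ν = l then 1 else 0 else 0)
            - (if μ = l then if ν = κ then 1 else 0 else 0) : ℂ) : Wick M)
          = (if μ = κ then if ν = l then 1 else 0 else 0)
            - (if μ = l then if ν = κ then 1 else 0 else 0) := by
        split_ifs <;> simp
      rw [← hC, ← hg, idlt_C]
      simp only [C_mul]; ring
    have h2 : (C (1 / 2) : Wick M) * 2 = 1 := by
      rw [show (2 : Wick M) = C 2 from (map_ofNat C 2).symm, ← C_mul]; norm_num
    funext a
    have hs : ∀ κ, (∑ l, if μ = κ then if ν = l then br (A 2 κ) (A 2 l) a else 0 else (0 : Wick M))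
        = if μ = κ then br (A 2 κ) (A 2 ν) a else 0 := fun κ => by
      split_ifs <;> simp
    simp only [Pi.add_apply, Finset.sum_apply, Pi.smul_apply, smul_eq_mul, hc, idlt_zero, zero_mul,
      Finset.sum_const_zero, zero_add, mul_assoc _ (_ - _), sub_mul, ite_mul, one_mul,
      ← Finset.mul_sum, Finset.sum_sub_distrib, hs, Finset.sum_ite_eq, Finset.mem_univ, if_true]
    rw [br_swap (A 2 ν), Pi.neg_apply]
    linear_combination (-C (-(1 / 2) * M.cF * Complex.I) * dlt 0 2 * br (A 2 μ) (A 2 ν) a) * h2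
  rw [obs_Q2delta (oDelta M) oDelta_w (fun μ χ a => by cases χ <;> simp [oDelta]) 0
    (fun μ ν κ l => C (-(1 / 2) * (M.cF : ℂ) * (η μ κ * η ν l - η μ l * η ν κ)))
    (fun μ a ν b κ => by simp [oDelta])
    (fun μ a ν b κ l => by simp [oDelta, GluonField.idx]) _ hW]
  simp only [← smul_smul, contrQ2_smul]
  refine Ideal.mul_mem_left _ _ (Ideal.mul_mem_left _ _ ?_)
  have hloc : dlt 0 2 * contrQ2 0 (fun μ ν => br (A 2 μ) (A 2 ν))
      = contrQ2 0 fun μ ν => (dlt 0 2 : Wick M) •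
        (br (A 2 μ) (A 2 ν) - br (A 0 μ) (A 0 ν) : LieW M) := by
    have h : (fun μ ν => br (A 2 μ) (A 2 ν) : Fin 4 → Fin 4 → LieW M)
        = fun μ ν => (br (A 2 μ) (A 2 ν) - br (A 0 μ) (A 0 ν)) + br (A 0 μ) (A 0 ν) := by
      funext μ ν; rw [sub_add_cancel]
    rw [h, contrQ2_add, contrQ2_br, add_zero, contrQ2_smul]
  rw [hloc]
  exact contrQ2_mem 0 fun μ ν =>
    br_loc (A_loc (by decide) μ) (A_loc (by decide) ν)

/-! ### The obstructions with string integrations -/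

/-- The metric factor of the contraction cancels the one in the lowered string operator, which
leaves literally a generator of the axiality violations times `i`. -/
theorem st'_axial {i j k : Fin 3} (hij : i ≠ j) (hk : k = i ∨ k = j) (p : KPoly) (a : Fin M.N) :
    (∑ μ, (C (g μ) * idlt i j (st' μ * p) : Wick M) • (A k μ : LieW M)) a
      ∈ axialityViolations M := by
  have h : (∑ μ, (C (g μ) * idlt i j (st' μ * p) : Wick M) • (A k μ : LieW M)) a
      = C Complex.I * ∑ μ, ker i j Base.delta (p * X (KOp.s' μ)) * fld k (.A a μ) 0 := by
    rw [Finset.sum_apply, Finset.mul_sum]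
    refine Finset.sum_congr rfl fun μ _ => ?_
    rw [Pi.smul_apply, smul_eq_mul, show st' μ * p = C (g μ) * (p * X (KOp.s' μ)) by rw [st']; ring,
      idlt_C_mul, ← mul_assoc (C (g μ)), ← C_mul, g_mul_self, C_1, one_mul, idlt, mul_assoc]
    rfl
  rw [h]
  exact Ideal.mul_mem_left _ _ (sum_s'_mul_mem_axialityViolations hij hk a p)

theorem st_axial {i j k : Fin 3} (hij : i ≠ j) (hk : k = i ∨ k = j) (p : KPoly) (a : Fin M.N) :
    (∑ μ, (C (g μ) * idlt i j (st μ * p) : Wick M) • (A k μ : LieW M)) a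
      ∈ axialityViolations M := by
  have h : (∑ μ, (C (g μ) * idlt i j (st μ * p) : Wick M) • (A k μ : LieW M)) a
      = C Complex.I * ∑ μ, ker i j Base.delta (p * X (KOp.s μ)) * fld k (.A a μ) 0 := by
    rw [Finset.sum_apply, Finset.mul_sum]
    refine Finset.sum_congr rfl fun μ _ => ?_
    rw [Pi.smul_apply, smul_eq_mul, show st μ * p = C (g μ) * (p * X (KOp.s μ)) by rw [st]; ring,
      idlt_C_mul, ← mul_assoc (C (g μ)), ← C_mul, g_mul_self, C_1, one_mul, idlt, mul_assoc]
    rfl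
  rw [h]
  exact Ideal.mul_mem_left _ _ (sum_s_mul_mem_axialityViolations hij hk a p)

/-- `I^{[κ}∂^{λ]} δ` contracted with `i[A_κ, A_λ]` violates axiality. -/
theorem st_br_axial {i j k : Fin 3} (hij : i ≠ j) (hk : k = i ∨ k = j) (a : Fin M.N) :
    (∑ κ, ∑ l, (C (g κ * g l) * idlt i j (st κ * pd l - st l * pd κ) : Wick M) •
      (br (A k κ) (A k l) : LieW M)) a ∈ axialityViolations M := by
  have h : (∑ κ, ∑ l, (C (g κ * g l) * idlt i j (st κ * pd l - st l * pd κ) : Wick M) •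
      (br (A k κ) (A k l) : LieW M))
      = ∑ l, br (∑ κ, (C (g κ) * idlt i j (st κ * pd l) : Wick M) • (A k κ : LieW M))
          ((C (g l) : Wick M) • A k l)
        + ∑ κ, br ((-C (g κ) : Wick M) • A k κ)
            (∑ l, (C (g l) * idlt i j (st l * pd κ) : Wick M) • (A k l : LieW M)) := by
    simp only [br_sum_left, br_sum_right, br_smul_left, br_smul_right, Finset.smul_sum, smul_smul]
    rw [Finset.sum_comm (s := Finset.univ (α := Fin 4)) (f := fun l κ =>
      (C (g l) * (C (g κ) * idlt i j (st κ * pd l)) : Wick M) • (br (A k κ) (A k l) : LieW M)),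
      ← Finset.sum_add_distrib]
    refine Finset.sum_congr rfl fun κ _ => ?_
    rw [← Finset.sum_add_distrib]
    refine Finset.sum_congr rfl fun l _ => ?_
    rw [← add_smul, idlt_sub, C_mul]
    congr 1; ring
  rw [h, Pi.add_apply, Finset.sum_apply, Finset.sum_apply]
  exact add_mem (sum_mem fun l _ => br_mem_left (st_axial hij hk _) _ a)
    (sum_mem fun κ _ => br_mem_right _ (st_axial hij hk _) a)

/-- The string-dependent parts of `O_μ(A_ν, A'^κ)`. -/
def oAA (ρ ν κ : Fin 4) : KPoly :=
  (C (3 / 2) * (st' ρ * pd ν + st' ν * pd ρ) - C (η ρ ν)) * st κ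
    + C (1 / 4 * η ρ ν) * stst * pd κ

theorem oAA_symm (ρ ν κ : Fin 4) : oAA ρ ν κ = oAA ν ρ κ := by
  rw [oAA, oAA, η_symm ρ ν]; ring

theorem oString_w_left (μ : Fin 4) (χ : GluonField M.N) (a : Fin M.N) :
    oString M μ (.w a) χ = 0 := by cases χ <;> simp [oString]

/-- The `F`–`A` obstruction contracts `I'^ν` with `A_ν` at `x`, a violation of axiality. The `A`–`A`
obstruction is symmetric and is contracted with `F^{μν}`, which is antisymmetric on shell. -/
theorem obs_Q1_oString_mem :
    obs (oString M) 0 1 (Q1 0) (L2 1) ∈ onShell M ⊔ axialityViolations M := by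
  rw [obs_Q1 (oString M) oString_w oString_w_left oAA (fun ν κ => st' ν * pd κ)
    (fun μ a ν b κ => rfl) (fun μ a ρ ν b κ => rfl)]
  refine Ideal.mul_mem_left _ _ (add_mem (Ideal.mem_sup_right ?_) (Ideal.mem_sup_left ?_))
  · have h : ∑ ν, ip (∑ κ, (C (g ν) * idlt 0 1 (st' ν * pd κ) : Wick M) • (cubic 1 κ : LieW M))
          (br (w 0) (A 0 ν))
        = ∑ κ, ip (cubic 1 κ) (br (w 0)
            (∑ ν, (C (g ν) * idlt 0 1 (st' ν * pd κ) : Wick M) • (A 0 ν : LieW M))) := by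
      simp only [ip_sum_left, ip_sum_right, br_sum_right, br_smul_right, ip_smul_left,
        ip_smul_right]
      exact Finset.sum_comm
    rw [h]
    exact sum_mem fun κ _ => ip_mem_right _
      (br_mem_right _ (st'_axial (by decide) (Or.inl rfl) _))
  · set Z : Fin 4 → Fin 4 → LieW M := fun μ ν =>
      ∑ κ, (idlt 0 1 (oAA μ ν κ) : Wick M) • (cubic 1 κ : LieW M)
    have hZ : ∀ μ ν, Z μ ν = Z ν μ := fun μ ν => by simp only [Z, oAA_symm μ ν]
    have h : ∑ μ, ∑ ν, C (g μ * g ν) * ip (Fdn 0 μ ν) (br (w 0) (Z μ ν))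
        = C (1 / 2) * ∑ μ, ∑ ν, C (g μ * g ν) *
          ip (Fdn 0 μ ν + Fdn 0 ν μ) (br (w 0) (Z μ ν)) := by
      have h2 : (C (1 / 2) : Wick M) * 2 = 1 := by
        rw [show (2 : Wick M) = C 2 from (map_ofNat C 2).symm, ← C_mul]; norm_num
      have hs : ∑ μ, ∑ ν, C (g μ * g ν) * ip (Fdn 0 ν μ) (br (w 0) (Z μ ν))
          = ∑ μ, ∑ ν, C (g μ * g ν) * ip (Fdn 0 μ ν) (br (w 0) (Z μ ν)) := by
        rw [Finset.sum_comm]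
        refine Finset.sum_congr rfl fun μ _ => Finset.sum_congr rfl fun ν _ => ?_
        rw [hZ, mul_comm (g μ)]
      simp only [ip_add_left, mul_add, Finset.sum_add_distrib, hs]
      generalize ∑ μ, ∑ ν, C (g μ * g ν) * ip (Fdn 0 μ ν) (br (w 0) (Z μ ν)) = P
      linear_combination (-P) * h2
    rw [h]
    exact Ideal.mul_mem_left _ _ (sum_mem fun μ _ => sum_mem fun ν _ =>
      Ideal.mul_mem_left _ _ (ip_mem_left (Fdn_antisymm_mem_onShell 0 μ ν) _))

/-- The part of `O_μ(A_ν, A'^κ)` with two free string-integrated derivatives. -/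
def oSymm (μ ν κ : Fin 4) : KPoly := C (3 / 2) * (st' μ * pd ν + st' ν * pd μ) * st κ

/-- The part of the contraction of `L_1` with `A_ν` that is symmetric and not diagonal. -/
def stringS (μ ν : Fin 4) : LieW M :=
  ∑ κ, (idlt 0 2 (oSymm μ ν κ) : Wick M) • (Jsym 2 κ : LieW M)

/-- The kernels `I^{[κ}∂^{λ]} δ` contracted with `i[A_κ, A_λ]`. -/
def stringB : LieW M :=
  ∑ κ, ∑ l, (C (g κ * g l) * idlt 0 2 (st κ * pd l - st l * pd κ) : Wick M) •
    (br (A 2 κ) (A 2 l) : LieW M)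

/-- The kernels `p_κ δ` contracted with the current. -/
def kerJ (p : Fin 4 → KPoly) : LieW M :=
  ∑ κ, (idlt 0 2 (p κ) : Wick M) • (Jsym 2 κ : LieW M)

/-- The part of the contraction of `L_1` with `A_ν` that is diagonal. -/
def stringV : LieW M :=
  kerJ (fun κ => C (1 / 4) * (stst * pd κ) - st κ) + (-C (1 / 8) : Wick M) • stringB

/-- Separates the terms proportional to the metric from the rest of the inserted matrix, to which
the symmetric and the diagonal contraction formulas apply respectively. The coefficient `-1/8` in
`stringV` is `-1/4` from the `A`–`F` obstruction times `1/2` from `L1`. -/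
theorem stringS_add_stringV (μ ν : Fin 4) :
    (stringS μ ν + (C (η μ ν) : Wick M) • stringV : LieW M)
      = ∑ κ, (idlt 0 2 (oAA μ ν κ) : Wick M) • (Jsym 2 κ : LieW M)
        + (C (1 / 2) : Wick M) • ∑ κ, ∑ l, (C (g κ * g l) *
          idlt 0 2 (-(C (1 / 4 * η μ ν) * (st κ * pd l - st l * pd κ))) : Wick M) •
          (br (A 2 κ) (A 2 l) : LieW M) := by
  have h1 : ∑ κ, ∑ l, (C (g κ * g l) *
        idlt 0 2 (-(C (1 / 4 * η μ ν) * (st κ * pd l - st l * pd κ))) : Wick M) •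
          (br (A 2 κ) (A 2 l) : LieW M) = (-C (1 / 4 * η μ ν) : Wick M) • stringB := by
    rw [stringB, Finset.smul_sum]
    refine Finset.sum_congr rfl fun κ _ => ?_
    rw [Finset.smul_sum]
    refine Finset.sum_congr rfl fun l _ => ?_
    rw [smul_smul, idlt_neg, idlt_C_mul]
    congr 1; ring
  have h2 : ∀ κ, (idlt 0 2 (oAA μ ν κ) : Wick M) = idlt 0 2 (oSymm μ ν κ)
      + C (η μ ν) * idlt 0 2 (C (1 / 4) * (stst * pd κ) - st κ) := fun κ => by
    rw [← idlt_C_mul, ← idlt_add]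
    congr 1
    simp only [oAA, oSymm, C_mul]; ring
  have h3 : ∑ κ, (idlt 0 2 (oAA μ ν κ) : Wick M) • (Jsym 2 κ : LieW M)
      = stringS μ ν
        + (C (η μ ν) : Wick M) • kerJ (fun κ => C (1 / 4) * (stst * pd κ) - st κ) := by
    rw [stringS, kerJ, Finset.smul_sum, ← Finset.sum_add_distrib]
    refine Finset.sum_congr rfl fun κ _ => ?_
    rw [smul_smul, ← add_smul, h2]
  have h4 : (C (1 / 2) * -C (1 / 4 * η μ ν) : Wick M) = C (η μ ν) * -C (1 / 8) := by
    rw [mul_neg, mul_neg, ← C_mul, ← C_mul]; congr 2; ring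
  rw [h1, h3, stringV, smul_add, smul_smul, smul_smul, h4, add_assoc]

theorem stringS_symm (μ ν : Fin 4) : (stringS μ ν : LieW M) = stringS ν μ := by
  simp only [stringS, oSymm]
  refine Finset.sum_congr rfl fun κ _ => ?_
  rw [add_comm (st' μ * pd ν)]

/-- The trace is `3 (I'∂) I_κ`. Writing `I'∂ = (I'∂ - 1) + 1` isolates a multiple of the string
identity, so that effectively `3 I_κ` remains. -/
theorem sum_stringS :
    (∑ μ, (C (g μ) : Wick M) • stringS μ μ : LieW M)
      = (3 : Wick M) • kerJ (fun κ => st κ * (∑ μ, X (KOp.s' μ) * pd μ - 1))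
        + (3 : Wick M) • kerJ st := by
  have hk : ∀ κ, ∑ μ, C (g μ) * oSymm μ μ κ
      = C 3 * (st κ * (∑ μ, X (KOp.s' μ) * pd μ - 1)) + C 3 * st κ := fun κ => by
    have h : ∀ μ, C (g μ) * oSymm μ μ κ = C 3 * st κ * (X (KOp.s' μ) * pd μ) := fun μ => by
      have hg : (C (g μ) * C (g μ) : KPoly) = 1 := by rw [← C_mul, g_mul_self, C_1]
      have h3 : (C (3 / 2) * 2 : KPoly) = C 3 := by
        rw [show (2 : KPoly) = C 2 from (map_ofNat C 2).symm, ← C_mul]; norm_num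
      rw [oSymm, st', ← h3]
      linear_combination (2 * C (3 / 2) * X (KOp.s' μ) * pd μ * st κ) * hg
    simp only [h, ← Finset.mul_sum]
    ring
  have h1 : ∀ κ, ∑ μ, C (g μ) * (idlt 0 2 (oSymm μ μ κ) : Wick M)
      = 3 * idlt 0 2 (st κ * (∑ μ, X (KOp.s' μ) * pd μ - 1)) + 3 * idlt 0 2 (st κ) := fun κ => by
    rw [show (3 : Wick M) = C 3 from (map_ofNat C 3).symm]
    simp only [← idlt_C_mul]
    rw [← idlt_sum, ← idlt_add, hk]
  simp only [stringS, kerJ, Finset.smul_sum, smul_smul]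
  rw [Finset.sum_comm, ← Finset.sum_add_distrib]
  refine Finset.sum_congr rfl fun κ _ => ?_
  rw [← Finset.sum_smul, h1, add_smul]

/-- Each of the two summands of the symmetrized kernel has a free index on `I'` that is contracted
with a field `A` at `x`: in one of them with the `A` inside the first bracket, in the other with the
`A` next to `w`. -/
theorem stringS_off_diagonal_mem :
    ∑ μ, ∑ l, C (g μ * g l) * ip (br (A 0 μ) (stringS μ l)) (br (w 0) (A 0 l))
      ∈ axialityViolations M := by
  set a : Fin 4 → Fin 4 → LieW M := fun l κ =>
    ∑ μ, (C (g μ) * idlt 0 2 (st' μ * (pd l * st κ)) : Wick M) • (A 0 μ : LieW M) with ha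
  have hm : ∀ l κ c, a l κ c ∈ axialityViolations M := fun l κ c =>
    st'_axial (by decide) (Or.inl rfl) _ c
  have h1 : ∀ κ l, ip (br (a l κ) (Jsym 2 κ)) (br (w 0) (A 0 l))
      = ∑ μ, C (g μ) * idlt 0 2 (st' μ * (pd l * st κ)) *
        ip (br (A 0 μ) (Jsym 2 κ)) (br (w 0) (A 0 l)) := fun κ l => by
    simp only [ha, br_sum_left, br_smul_left, ip_sum_left, ip_smul_left]
  have h2 : ∀ κ μ, ip (br (A 0 μ) (Jsym 2 κ)) (br (w 0) (a μ κ))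
      = ∑ l, C (g l) * idlt 0 2 (st' l * (pd μ * st κ)) *
        ip (br (A 0 μ) (Jsym 2 κ)) (br (w 0) (A 0 l)) := fun κ μ => by
    simp only [ha, br_sum_right, br_smul_right, ip_sum_right, ip_smul_right]
  have h3 : ∀ μ l, (ip (br (A 0 μ) (stringS μ l)) (br (w 0) (A 0 l)) : Wick M)
      = ∑ κ, C (3 / 2) * (idlt 0 2 (st' μ * (pd l * st κ)) + idlt 0 2 (st' l * (pd μ * st κ))) *
        ip (br (A 0 μ) (Jsym 2 κ)) (br (w 0) (A 0 l)) := fun μ l => by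
    simp only [stringS, br_sum_right, br_smul_right, ip_sum_left, ip_smul_left]
    refine Finset.sum_congr rfl fun κ _ => ?_
    rw [← idlt_add, ← idlt_C_mul]
    congr 2
    rw [oSymm]; ring
  have h : ∑ μ, ∑ l, C (g μ * g l) * ip (br (A 0 μ) (stringS μ l)) (br (w 0) (A 0 l))
      = ∑ κ, (∑ l, C (3 / 2) * C (g l) * ip (br (a l κ) (Jsym 2 κ)) (br (w 0) (A 0 l))
        + ∑ μ, C (3 / 2) * C (g μ) * ip (br (A 0 μ) (Jsym 2 κ)) (br (w 0) (a μ κ))) := by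
    simp only [h1, h2, h3, Finset.mul_sum]
    rw [Finset.sum_congr rfl fun μ _ => Finset.sum_comm, Finset.sum_comm]
    refine Finset.sum_congr rfl fun κ _ => ?_
    rw [Finset.sum_comm (f := fun l μ => C (3 / 2) * C (g l) * (C (g μ) *
          idlt 0 2 (st' μ * (pd l * st κ)) * ip (br (A 0 μ) (Jsym 2 κ)) (br (w 0) (A 0 l)))),
      ← Finset.sum_add_distrib]
    refine Finset.sum_congr rfl fun μ _ => ?_
    rw [← Finset.sum_add_distrib]
    refine Finset.sum_congr rfl fun l _ => ?_
    rw [C_mul]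
    ring
  rw [h]
  refine sum_mem fun κ _ => add_mem (sum_mem fun l _ => Ideal.mul_mem_left _ _ ?_)
    (sum_mem fun μ _ => Ideal.mul_mem_left _ _ ?_)
  · exact ip_mem_left (br_mem_left (hm l κ) _) _
  · exact ip_mem_right _ (br_mem_right _ (hm μ κ))

theorem contrDiag_kerJ (p : Fin 4 → KPoly) :
    contrDiag 0 (kerJ p : LieW M) = ∑ κ, idlt 0 2 (p κ) * contrDiag 0 (Jsym 2 κ) := by
  simp only [kerJ, contrDiag_sum, contrDiag_smul]

/-- The contraction of `Q_2|_δ` with the string-integrated two-point obstructions is, up to violations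
of axiality, given by the kernel `(II')∂_κ δ` and the conserved current. -/
theorem obs_Q2delta_oString : obs (oString M) 0 2 (Q2delta 0) (L1 2)
    - C (-2 * (1 + (M.cF : ℂ)) * (3 / 4)) *
        ∑ κ, idlt 0 2 (stst * pd κ) * contrDiag 0 (Jsym 2 κ) ∈ onShell M ⊔ axialityViolations M := by
  have hT : contrDiag 0 (kerJ (fun κ => st κ * (∑ μ, X (KOp.s' μ) * pd μ - 1)) : LieW M)
      ∈ onShell M := by
    rw [contrDiag_kerJ]
    exact sum_mem fun κ _ => Ideal.mul_mem_right _ _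
      (Ideal.mul_mem_left _ _ (Rel.string' 0 2 Base.delta (st κ)).mem_onShell)
  have hB : contrDiag 0 (stringB : LieW M) ∈ axialityViolations M :=
    contrDiag_mem 0 (st_br_axial (by decide) (Or.inr rfl))
  have hO := stringS_off_diagonal_mem (M := M)
  have hV : contrDiag 0 (kerJ (fun κ => C (1 / 4) * (stst * pd κ) - st κ) : LieW M)
      = C (1 / 4) * ∑ κ, idlt 0 2 (stst * pd κ) * contrDiag 0 (Jsym 2 κ)
        - contrDiag 0 (kerJ st) := by
    rw [contrDiag_kerJ, contrDiag_kerJ, Finset.mul_sum, ← Finset.sum_sub_distrib]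
    refine Finset.sum_congr rfl fun κ _ => ?_
    rw [idlt_sub, idlt_C_mul]; ring
  rw [obs_Q2delta (oString M) oString_w oString_w_left oAA
    (fun μ ν κ l => -(C (1 / 4 * η μ ν) * (st κ * pd l - st l * pd κ)))
    (fun μ a ν b κ => rfl) (fun μ a ν b κ l => rfl) _ stringS_add_stringV, contrQ2_add, contrQ2_diag,
    contrQ2_symm 0 stringS stringS_symm, sum_stringS, stringV, contrDiag_add, contrDiag_add,
    contrDiag_smul, contrDiag_smul, contrDiag_smul, hV]
  -- The contributions `3 I_κ` of the trace and `-3 I_κ` of the diagonal part cancel, and `3 · 1/4`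
  -- is the coefficient of the surviving kernel `(II')∂_κ δ`.
  have h34 : (C (-2 * (1 + (M.cF : ℂ)) * (3 / 4)) : Wick M)
      = C (-2 * (1 + (M.cF : ℂ))) * (3 * C (1 / 4)) := by
    rw [show (3 : Wick M) = C 3 from (map_ofNat C 3).symm, ← C_mul, ← C_mul]; norm_num
  rw [h34]
  generalize contrDiag 0 (kerJ (fun κ => st κ * (∑ μ, X (KOp.s' μ) * pd μ - 1)) : LieW M) = T at *
  generalize contrDiag 0 (stringB : LieW M) = B at *
  generalize ∑ μ, ∑ l, C (g μ * g l) * ip (br (A 0 μ) (stringS μ l)) (br (w 0) (A 0 l)) = O at *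
  have hmem : C (-2 * (1 + (M.cF : ℂ))) * (3 * T + O + 3 * (-C (1 / 8) * B))
      ∈ onShell M ⊔ axialityViolations M :=
    Ideal.mul_mem_left _ _ (add_mem (add_mem (Ideal.mul_mem_left _ _ (Ideal.mem_sup_left hT))
      (Ideal.mem_sup_right hO))
      (Ideal.mul_mem_left _ _ (Ideal.mul_mem_left _ _ (Ideal.mem_sup_right hB))))
  convert hmem using 1
  ring

/-- The string-localized vector field whose divergence is `O_{Q_2|_δ}(L_1'')|_{Iδ}`, up to violations
of axiality. -/
def remainFlow (M : Model) (κ : Fin 4) : Wick M :=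
  C (3 / 4 * (1 + (M.cF : ℂ)) * Complex.I) *
    (dlt 0 1 * ker 0 2 Base.delta stst * contrDiag 0 (Jsym 2 κ))

theorem D_contrDiag {k i : Fin 3} (h : k ≠ i) (κ : Fin 4) (V : LieW M) :
    D k κ (contrDiag i V) = contrDiag i (mapLie (D k κ) V) := by
  have hA : ∀ l, mapLie (D k κ) (A i l : LieW M) = 0 := fun l =>
    mapLie_D_of_ne h (fun a => .A a l) κ
  have hw : mapLie (D k κ) (w i : LieW M) = 0 := mapLie_D_of_ne h (fun a => .w a) κ
  simp only [contrDiag, map_sum, der_C_mul, der_ip, mapLie_br, hA, hw, br_zero_left, br_zero_right,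
    add_zero, ip_zero_right]

/-- Integration by parts: `x''` is the second argument of the kernel, so its derivative acts as
`-∂_κ` there, while the derivative of the current at `x''` vanishes by current conservation. The
remaining factors do not depend on `x''`. -/
theorem remainSecond_sub_mem :
    remainSecond M - ∑ κ, D 2 κ (remainFlow M κ) ∈ onShell M ⊔ axialityViolations M := by
  have hD : ∑ κ, D 2 κ (remainFlow M κ)
      = C (3 / 4 * (1 + (M.cF : ℂ)) * Complex.I) * (dlt 0 1 * ker 0 2 Base.delta stst)
          * contrDiag 0 (∑ κ, mapLie (D 2 κ) (Jsym 2 κ))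
        - C (3 / 4 * (1 + (M.cF : ℂ))) * dlt 0 1 *
          ∑ κ, idlt 0 2 (stst * pd κ) * contrDiag 0 (Jsym 2 κ) := by
    rw [contrDiag_sum, Finset.mul_sum, Finset.mul_sum, ← Finset.sum_sub_distrib]
    refine Finset.sum_congr rfl fun κ _ => ?_
    have h1 : D 2 κ (dlt 0 1 : Wick M) = 0 := by simp [dlt, D_ker]
    have h2 : D 2 κ (ker 0 2 Base.delta stst : Wick M) = -ker 0 2 Base.delta (stst * pd κ) := by
      simp [D_ker]
    rw [remainFlow, der_C_mul, Derivation.leibniz, Derivation.leibniz, h1, h2,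
      D_contrDiag (by decide), idlt, C_mul (a := 3 / 4 * (1 + (M.cF : ℂ)))]
    simp only [smul_eq_mul]
    ring
  have h := Ideal.mul_mem_left _ (C (1 / 2) * dlt 0 1) (obs_Q2delta_oString (M := M))
  have h' : C (3 / 4 * (1 + (M.cF : ℂ)) * Complex.I) * (dlt 0 1 * ker 0 2 Base.delta stst)
      * contrDiag 0 (∑ κ, mapLie (D 2 κ) (Jsym 2 κ)) ∈ onShell M ⊔ axialityViolations M :=
    Ideal.mul_mem_left _ _ (Ideal.mem_sup_left (contrDiag_mem 0 (sum_D_Jsym_mem_onShell 2)))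
  convert sub_mem h h' using 1
  -- The normalization of the flow combines `1/2` from the symmetrized obstruction with the
  -- coefficient just found; its sign compensates the minus sign from differentiating the second
  -- argument.
  have hc : (C (3 / 4 * (1 + (M.cF : ℂ))) : Wick M)
      = -(C (1 / 2) * C (-2 * (1 + (M.cF : ℂ)) * (3 / 4))) := by
    rw [← C_mul, ← C_neg]; congr 1; ring
  rw [hD, remainSecond, symObs_Q2delta, hc]
  ring

/-! ### Splitting of the full obstructions into delta and string parts -/

theorem contr_add (i : Fin 3) (h h' : GluonField M.N → Wick M) (P : Wick M) :
    contr i (fun φ => h φ + h' φ) P = contr i h P + contr i h' P := by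
  obtain ⟨ι, _, u, hu⟩ := sumAFw_eq_sum (M := M)
  simp only [← sumAFw_pderiv, hu, mul_add, Finset.sum_add_distrib]

theorem obs_oFull (i j : Fin 3) (Y : Fin 4 → Wick M) (V : Wick M)
    (hY : ∀ μ φ ν, pderiv (Gen.field i φ (e1 ν)) (Y μ) = 0) (hV : ∀ μ, D i μ V = 0) :
    obs (oFull M) i j Y V = obs (oDelta M) i j Y V + obs (oString M) i j Y V := by
  rw [obs_eq _ oFull_w i j Y V hY hV, obs_eq _ oDelta_w i j Y V hY hV,
    obs_eq _ oString_w i j Y V hY hV, ← Finset.sum_add_distrib]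
  refine Finset.sum_congr rfl fun μ _ => ?_
  simp only [oFull, idlt_add, contr_add]

theorem symObs_oDelta_mem : symObs (oDelta M) (Q2delta 0) (L1 2) ∈ onShell M := by
  rw [symObs_Q2delta]
  exact Ideal.mul_mem_left _ _ (Ideal.mul_mem_left _ _ obs_Q2delta_oDelta_mem)

theorem symObs_oFull : symObs (oFull M) (Q2delta 0) (L1 2)
    = symObs (oDelta M) (Q2delta 0) (L1 2) + remainSecond M := by
  rw [remainSecond, symObs_Q2delta, symObs_Q2delta, symObs_Q2delta,
    obs_oFull 0 2 _ _ (fun μ φ ν => pderiv_e1_Q2delta 0 φ μ ν) (fun μ => D_L1 (by decide) μ)]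
  ring

theorem obs_Q1_oFull : obs (oFull M) 0 1 (Q1 0) (L2 1)
    = obs (oDelta M) 0 1 (Q1 0) (L2 1) + obs (oString M) 0 1 (Q1 0) (L2 1) :=
  obs_oFull 0 1 _ _ (fun μ φ ν => pderiv_e1_Q1 0 φ μ ν) (fun μ => D_L2 (by decide) μ)

/-! ### Localization of the flow -/

theorem br_mem_stringLocal {X Y : LieW M} (hX : ∀ a, X a ∈ stringLocal M)
    (hY : ∀ a, Y a ∈ stringLocal M) (c : Fin M.N) : br X Y c ∈ stringLocal M :=
  neg_mem (sum_mem fun a _ => sum_mem fun b _ =>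
    mul_mem (mul_mem (C_mem_stringLocal _) (hX a)) (hY b))

theorem ip_mem_stringLocal {X Y : LieW M} (hX : ∀ a, X a ∈ stringLocal M)
    (hY : ∀ a, Y a ∈ stringLocal M) : ip X Y ∈ stringLocal M :=
  sum_mem fun a _ => mul_mem (hX a) (hY a)

theorem Jsym_mem_stringLocal (j : Fin 3) (κ : Fin 4) (a : Fin M.N) :
    Jsym j κ a ∈ stringLocal M := by
  have hA : ∀ ν b, A j ν b ∈ stringLocal M := fun ν b => fld_mem_stringLocal j (.A b ν) 0
  have hF : ∀ μ ν b, Fup j μ ν b ∈ stringLocal M := fun μ ν b =>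
    mul_mem (C_mem_stringLocal _) (fld_mem_stringLocal j (.F b μ ν) 0)
  have hc : cur j κ a ∈ stringLocal M := sum_mem fun s _ => sum_mem fun s' _ => sum_mem fun m _ =>
    sum_mem fun n _ => mul_mem (C_mem_stringLocal _) (bil_mem_stringLocal _ _)
  rw [Jsym, Pi.add_apply, Pi.smul_apply, Finset.sum_apply, smul_eq_mul]
  exact add_mem hc (mul_mem (C_mem_stringLocal _) (sum_mem fun ν _ =>
    add_mem (br_mem_stringLocal (hA ν) (hF κ ν) a) (br_mem_stringLocal (hF ν κ) (hA ν) a)))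

theorem contrDiag_mem_stringLocal (i : Fin 3) {V : LieW M} (hV : ∀ a, V a ∈ stringLocal M) :
    contrDiag i V ∈ stringLocal M :=
  sum_mem fun l _ => mul_mem (C_mem_stringLocal _) (ip_mem_stringLocal
    (br_mem_stringLocal hV fun a => fld_mem_stringLocal i (.A a l) 0)
    (br_mem_stringLocal (fun a => fld_mem_stringLocal i (.w a) 0)
      fun a => fld_mem_stringLocal i (.A a l) 0))

theorem remainFlow_mem_stringLocal (κ : Fin 4) : remainFlow M κ ∈ stringLocal M :=
  mul_mem (C_mem_stringLocal _) (mul_mem (mul_mem (dlt_mem_stringLocal _ _)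
    (ker_stst_mem_stringLocal _ _)) (contrDiag_mem_stringLocal 0 (Jsym_mem_stringLocal 2 κ)))

theorem ker_stst_mem_stringTerms (i j : Fin 3) : ker i j Base.delta stst ∈ stringTerms M := by
  rw [stst, map_sum]
  refine sum_mem fun μ _ => Ideal.subset_span ⟨i, j, μ, st' μ, Or.inl ?_⟩
  rw [mul_comm]

/-- The factor `(II')δ` is a string-integrated delta function between whichever two points the
renaming assigns to it. -/
theorem permW_remainFlow_mem_stringTerms (σ : Equiv.Perm (Fin 3)) (κ : Fin 4) :
    permW σ (remainFlow M κ) ∈ stringTerms M := by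
  have h : permW σ (remainFlow M κ) = permW σ (C (3 / 4 * (1 + (M.cF : ℂ)) * Complex.I)) *
      (permW σ (dlt 0 1) * ker (σ 0) (σ 2) Base.delta stst
        * permW σ (contrDiag 0 (Jsym 2 κ))) := by
    rw [← permW_ker, ← map_mul, ← map_mul, ← map_mul, remainFlow]
  rw [h]
  exact Ideal.mul_mem_left _ _ (Ideal.mul_mem_right _ _
    (Ideal.mul_mem_left _ _ (ker_stst_mem_stringTerms _ _)))

theorem isTotalDerivative_remainSecond :
    IsTotalDerivative (onShell M ⊔ axialityViolations M) (remainSecond M) := by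
  refine ⟨fun i κ => if i = 2 then remainFlow M κ else 0, fun i κ => ?_, ?_⟩
  · dsimp only
    split_ifs
    exacts [remainFlow_mem_stringLocal κ, zero_mem _]
  · have h : ∑ i, ∑ μ, D i μ (if i = 2 then remainFlow M μ else 0)
        = ∑ κ, D 2 κ (remainFlow M κ) := by
      rw [Finset.sum_eq_single 2]
      · simp
      · intro i _ hi; simp [hi]
      · simp
    rw [h]
    exact remainSecond_sub_mem

/-! ### The sharp string -/

variable (e : Fin 4 → ℝ)

theorem sup_le_onShellSharp : onShell M ⊔ axialityViolations M ≤ onShellSharp M e :=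
  sup_le (onShell_le_onShellSharp e) (axialityViolations_le_onShellSharp e)

/-- By bilinearity the kernel is absorbed into the second entry of the bracket, which becomes `A'_ν
I^ν δ`, a contraction of a string integration with `A`. -/
theorem w2_mem_onShellSharp (a : Fin M.N) : w2 a ∈ onShellSharp M e := by
  have h : (w2 a : Wick M) = br (w 1)
      (∑ ν, (ker 0 1 Base.delta (X (KOp.s ν)) : Wick M) • (A 1 ν : LieW M)) a := by
    rw [w2, br_sum_right, Finset.sum_apply]
    refine Finset.sum_congr rfl fun ν _ => ?_
    rw [br_smul_right, Pi.smul_apply, smul_eq_mul, mul_comm]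
  rw [h]
  refine br_mem_right _ (fun b => ?_) a
  have := sum_s_mul_mem_onShellSharp (e := e) 0 1 1 Base.delta b 1
  simp only [one_mul] at this
  simp only [Finset.sum_apply, Pi.smul_apply, smul_eq_mul]
  exact this

/-- Both `w2` and its derivatives vanish for a sharp string, and the prescription sends vanishing
fields to vanishing ones; no further property of the time-ordered products is needed. -/
theorem remainFirst_mem_onShellSharp {T2 : Wick M →ₗ[ℂ] Wick M}
    (hT : ∀ P ∈ onShellSharp M e, T2 P ∈ onShellSharp M e) :
    remainFirst T2 ∈ onShellSharp M e :=
  sum_mem fun μ _ => sum_mem fun a _ => Ideal.mul_mem_left _ _ <| sub_mem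
    (hT _ (D_mem_diffIdeal 0 μ (w2_mem_onShellSharp e a)))
    (D_mem_diffIdeal 0 μ (hT _ (w2_mem_onShellSharp e a)))

theorem sum_w2_mem_onShellSharp : ∑ a, C 2 * w2 a * obsJ a ∈ onShellSharp M e :=
  sum_mem fun a _ => Ideal.mul_mem_right _ _ (Ideal.mul_mem_left _ _ (w2_mem_onShellSharp e a))

theorem O3w2_mem_onShellSharp : O3w2 M ∈ onShellSharp M e :=
  sym3_mem_onShellSharp (add_mem (sum_w2_mem_onShellSharp e)
    (Ideal.mul_mem_right _ _ (sup_le_onShellSharp e obs_Q1_oString_mem)))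

/-- The resolution requires derivatives with respect to `x` only; under the symmetrization `x` and
`x''` may be exchanged. -/
theorem sum_D_remainFlow :
    sym3 (∑ κ, D 2 κ (remainFlow M κ))
      = sym3 (∑ κ, D 0 κ (permW (Equiv.swap 0 2) (remainFlow M κ))) := by
  rw [← sym3_permW (Equiv.swap 0 2), map_sum]
  simp only [permW_D, Equiv.swap_apply_right]

/-- All contributions vanish for a sharp string except the divergence of the flow. The factor `-3`
combines the `3` in `O3` with the sign in front of `∂_μ Q_3^μ`. -/
theorem resolves_O3 {T2 : Wick M →ₗ[ℂ] Wick M}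
    (hT : ∀ P ∈ onShellSharp M e, T2 P ∈ onShellSharp M e) :
    Resolves (onShellSharp M e) (O3 T2) 0
      fun κ => C (-3) * permW (Equiv.swap 0 2) (remainFlow M κ) := by
  have hd : (∑ κ, D 0 κ (C (-3) * permW (Equiv.swap 0 2) (remainFlow M κ)) : Wick M)
      = C (-3) * ∑ κ, D 0 κ (permW (Equiv.swap 0 2) (remainFlow M κ)) := by
    simp only [der_C_mul, Finset.mul_sum]
  rw [Resolves, map_zero, zero_mul, zero_sub, sub_neg_eq_add, hd, sym3_C_mul, ← sum_D_remainFlow,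
    O3, obs_Q1_oFull, symObs_oFull]
  have h := Ideal.mul_mem_left _ (C 3) (sym3_mem_onShellSharp (e := e)
    (add_mem (add_mem (add_mem (Ideal.mul_mem_right (dlt 1 2) _ (add_mem
      (onShell_le_onShellSharp e (obs_Q1_oDelta_mem (M := M)))
      (sup_le_onShellSharp e obs_Q1_oString_mem)))
      (add_mem (onShell_le_onShellSharp e symObs_oDelta_mem)
        (sup_le_onShellSharp e remainSecond_sub_mem)))
      (remainFirst_mem_onShellSharp e hT)) (sum_w2_mem_onShellSharp e)))
  convert h using 1
  simp only [sym3_add, sym3_sub, C_neg]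
  ring

end

end SQCD

end

theorem propositionp (M : SQCD.Model) :
    -- the second term of the remainder is a derivative, up to violations of axiality
    -- (for the full obstruction, and for its part with string-integrated delta functions)
    SQCD.IsTotalDerivative (SQCD.onShell M ⊔ SQCD.axialityViolations M)
      (SQCD.symObs (SQCD.oFull M) (SQCD.Q2delta 0) (SQCD.L1 2)) ∧
    SQCD.IsTotalDerivative (SQCD.onShell M ⊔ SQCD.axialityViolations M)
      (SQCD.remainSecond M) ∧
    -- the part without string-integrated delta functions vanishes
    SQCD.O3loc M ∈ SQCD.onShell M ∧
    -- the sharp string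
    ∀ e : Fin 4 → ℝ, e 0 ^ 2 - e 1 ^ 2 - e 2 ^ 2 - e 3 ^ 2 = -1 →
      (∀ a, SQCD.w2 a ∈ SQCD.onShellSharp M e) ∧
      SQCD.IsTotalDerivative (SQCD.onShellSharp M e) (SQCD.remainSecond M) ∧
      SQCD.IsTotalDerivative (SQCD.onShellSharp M e) (SQCD.O3w2 M) ∧
      -- whatever the prescription for time-ordered products of kernels with string-integrated
      -- delta functions: the remainder is a derivative, and `L_3 = 0` resolves
      -- the third-order obstruction
      ∀ T2 : SQCD.Wick M →ₗ[ℂ] SQCD.Wick M,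
        (∀ P ∈ SQCD.onShellSharp M e, T2 P ∈ SQCD.onShellSharp M e) →
        SQCD.IsTotalDerivative (SQCD.onShellSharp M e) (SQCD.O3remain T2) ∧
        ∃ Q3 : Fin 4 → SQCD.Wick M,
          (∀ μ, Q3 μ ∈ SQCD.stringLocal M ∧ Q3 μ ∈ SQCD.stringTerms M) ∧
          SQCD.Resolves (SQCD.onShellSharp M e) (SQCD.O3 T2) 0 Q3 := by
  refine ⟨?_, SQCD.isTotalDerivative_remainSecond, ?_, fun e _ => ⟨SQCD.w2_mem_onShellSharp e,
    SQCD.isTotalDerivative_remainSecond.mono (SQCD.sup_le_onShellSharp e),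
    .of_mem (SQCD.O3w2_mem_onShellSharp e), fun T2 hT => ⟨?_, _, fun κ => ⟨?_, ?_⟩,
    SQCD.resolves_O3 e hT⟩⟩⟩
  · rw [SQCD.symObs_oFull]
    exact SQCD.isTotalDerivative_remainSecond.add_mem
      (Ideal.mem_sup_left SQCD.symObs_oDelta_mem)
  -- The two summands vanish separately; no cancellation between them is required.
  · exact add_mem (Ideal.mul_mem_right _ _ SQCD.obs_Q1_oDelta_mem) SQCD.symObs_oDelta_mem
  · exact ((SQCD.isTotalDerivative_remainSecond.mono (SQCD.sup_le_onShellSharp e)).add_mem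
      (SQCD.remainFirst_mem_onShellSharp e hT)).symmetrize
  · exact mul_mem (SQCD.C_mem_stringLocal _)
      (SQCD.permW_mem_stringLocal _ (SQCD.remainFlow_mem_stringLocal κ))
  · exact Ideal.mul_mem_left _ _ (SQCD.permW_remainFlow_mem_stringTerms _ κ)
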